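/- **Setting.** Fix an integer $\Delta\ge 3$ and a real $\alpha\ge 1$. Inputs are finite simple graphs $G=(V,E)$ (not necessarily connected) of maximum degree at most $\Delta$, in which the edges at each node $v$ are numbered by ports $1,\dots,\deg(v)$, and each node has a unique identifier in $\{1,\dots,\lfloor n^\alpha\rfloor\}$, $n=|V|$, and an input label. *Algorithms.* An execution of an algorithm $A$ initiated at $v$ knows $n$ and the identifier, degree and label of $v$, and maintains a set $V_v$ of visited nodes, initially $\{v\}$. In each step it adaptively queries a port $j\in\{1,\dots,\deg(w)\}$ of some $w\in V_v$; it then learns the identifier, degree and label of the neighbor $u$ of $w$ behind that port, and $u$ is added to $V_v$. At some point it may halt with an output. In a randomized algorithm every node has in addition a private string of independent uniform random bits, which is part of its input: an execution may read, sequentially, the bits of any node it has visited. Deterministic algorithms read no random bits. On each input, a randomized algorithm reads at most some finite number of bits (which may depend on the input) with probability $1-O(1/n)$. *Complexity.* The distance cost of an execution from $v$ is $\max_{w\in V_v}\mathrm{dist}(v,w)$ and its volume cost is $|V_v|$, for the final set $V_v$. The cost of $A$ at $n$ is the supremum over all inputs with at most $n$ nodes, all starting nodes and all random strings. A deterministic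 algorithm solves a problem if its outputs at all nodes form a valid solution on every input; a randomized one solves it if on every input this happens with probability $1-O(1/n)$. The complexities D-DIST, D-VOL (deterministic) and R-DIST, R-VOL (randomized) of a problem are the infima of the distance and volume cost over all algorithms that solve it. In the randomized case these are taken, for every fixed $K>0$, over the algorithms for which both probabilities $1-O(1/n)$ above are at least $1-K/n$. "The complexity is $\Theta(f(n))$" means that there are constants $c,C>0$, independent of $K$, such that for all large $n$ the infimum is at least $c f(n)$, and that some single algorithm solving the problem has cost at most $C f(n)$ for all large $n$. *LeafColoring.* The label of $v$ consists of a parent $\mathrm P(v)$, a left child $\mathrm{LC}(v)$ and a right child $\mathrm{RC}(v)$ in $\{1,\dots,\Delta\}\cup\{\bot\}$, those that are not $\bot$ being pairwise distinct, and a color $\chi_{\mathrm{in}}(v)\in\{R,B\}$. A port number is identified with the neighbor of $v$ behind that port (if there is one). A node $v$ is *internal* if $\mathrm P(\mathrm{LC}(v))=v$ and $\mathrm P(\mathrm{RC}(v))=v$; it is a *leaf* if $\mathrm{LC}(v)=\mathrm{RC}(v)=\bot$ and $\mathrm P(v)$ is internal; otherwise it is *inconsistent*. Each node outputs a color $\chi_{\mathrm{out}}(v)\in\{R,B\}$;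 the output is valid if $\chi_{\mathrm{out}}(v)=\chi_{\mathrm{in}}(v)$ for every $v$ that is a leaf or inconsistent, and $\chi_{\mathrm{out}}(v)\in\{\chi_{\mathrm{out}}(\mathrm{LC}(v)),\chi_{\mathrm{out}}(\mathrm{RC}(v))\}$ for every internal $v$. **Theorem.** The complexity of LeafColoring is $$\text{R-DIST}=\Theta(\log n),\qquad \text{D-DIST}=\Theta(\log n),\qquad \text{R-VOL}=\Theta(\log n),\qquad \text{D-VOL}=\Theta(n).$$ -/

import Mathlib

namespace VolumeModel

/-! ## Labeled graphs -/

/-- A finite graph of maximum degree at most `Δ`, with a port ordering, unique identifiers from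
`{1, …, ⌊n ^ α⌋}` (where `n` is the number of nodes), and an input label in `L` at every node.
The ports of `v` are numbered `0, …, deg v - 1`; the bijection `port v` forces `deg v` to be the
degree of `v`. -/
structure LabeledGraph (Δ : ℕ) (α : ℝ) (L : Type) : Type 1 where
  V : Type
  [fintypeV : Fintype V]
  graph : SimpleGraph V
  deg : V → ℕ
  port : (v : V) → Fin (deg v) ≃ graph.neighborSet v
  deg_le : ∀ v, deg v ≤ Δ
  ident : V → ℕ
  ident_injective : Function.Injective ident
  one_le_ident : ∀ v, 1 ≤ ident v
  ident_le : ∀ v, (ident v : ℝ) ≤ (Fintype.card V : ℝ) ^ α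
  label : V → L

attribute [instance] LabeledGraph.fintypeV

/-- What an algorithm learns about a node on visiting it: its identifier, degree and label. -/
structure NodeView (L : Type) where
  ident : ℕ
  deg : ℕ
  label : L

namespace LabeledGraph

variable {Δ : ℕ} {α : ℝ} {L : Type}

/-- The number of nodes. -/
def size (G : LabeledGraph Δ α L) : ℕ := Fintype.card G.V

/-- The neighbor of `v` behind port `j`, if `v` has such a port. -/
def neighbor (G : LabeledGraph Δ α L) (v : G.V) (j : ℕ) : Option G.V :=
  if h : j < G.deg v then some (G.port v ⟨j, h⟩ : G.V) else none

def view (G : LabeledGraph Δ α L) (v : G.V) : NodeView L := ⟨G.ident v, G.deg v, G.label v⟩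

/-- A random string for every node: `r (v, i)` is the `i`-th random bit of node `v`. -/
abbrev RandomBits (G : LabeledGraph Δ α L) : Type := G.V × ℕ → Bool

/-- All random bits of all nodes are independent and uniform. -/
noncomputable def bitMeasure (G : LabeledGraph Δ α L) : MeasureTheory.Measure G.RandomBits :=
  MeasureTheory.Measure.infinitePi fun _ => (PMF.uniformOfFintype Bool).toMeasure

end LabeledGraph

/-! ## Algorithms and executions -/

/-- One step of an execution: query port `j` of the visited node with identifier `w`, read the next
unread bit of the random string of the visited node with identifier `w`, or halt with an output. -/
inductive Action (O : Type) : Type where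
  | query (w j : ℕ)
  | readBit (w : ℕ)
  | output (o : O)

/-- The answer to a step. The answer `invalid`, which carries no information, is given if the
action refers to a node that has not been visited or to a port that does not exist. -/
inductive Answer (L : Type) : Type where
  | node (info : NodeView L)
  | bit (b : Bool)
  | invalid

/-- An algorithm chooses its next action from the number of nodes, the view of the node at which
the execution was initiated, and the answers received so far (oldest first). -/
structure Algorithm (L O : Type) : Type where
  next : ℕ → NodeView L → List (Answer L) → Action O

/-- The state of an execution. -/
structure ExecState {Δ : ℕ} {α : ℝ} {L : Type} (G : LabeledGraph Δ α L) : Type where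
  history : List (Answer L)
  visited : List G.V
  bitsRead : G.V → ℕ

namespace Algorithm

variable {Δ : ℕ} {α : ℝ} {L O : Type}

/-- A deterministic algorithm never reads a random bit. -/
def IsDeterministic (A : Algorithm L O) : Prop :=
  ∀ n i h w, A.next n i h ≠ Action.readBit w

/-- The effect of an action on the state; after halting the state does not change any more. -/
def act (G : LabeledGraph Δ α L) (r : G.RandomBits) (s : ExecState G) :
    Action O → ExecState G
  | .output _ => s
  | .query i j =>
    match (s.visited.find? fun w => G.ident w == i).bind fun w => G.neighbor w j with
    | some u => { s with history := s.history ++ [.node (G.view u)], visited := u :: s.visited }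
    | none => { s with history := s.history ++ [.invalid] }
  | .readBit i =>
    match s.visited.find? fun w => G.ident w == i with
    | some w =>
      { s with
        history := s.history ++ [.bit (r (w, s.bitsRead w))]
        bitsRead := fun u => if G.ident u = i then s.bitsRead u + 1 else s.bitsRead u }
    | none => { s with history := s.history ++ [.invalid] }

/-- The state after `t` steps of the execution of `A` on `G` initiated at `v`. -/
def exec (A : Algorithm L O) (G : LabeledGraph Δ α L) (r : G.RandomBits) (v : G.V) :
    ℕ → ExecState G
  | 0 => { history := [], visited := [v], bitsRead := fun _ => 0 }
  | t + 1 => act G r (exec A G r v t) (A.next G.size (G.view v) (exec A G r v t).history)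

/-- The execution of `A` initiated at `v` halts with output `o`. -/
def Outputs (A : Algorithm L O) (G : LabeledGraph Δ α L) (r : G.RandomBits) (v : G.V) (o : O) :
    Prop :=
  ∃ t, A.next G.size (G.view v) (exec A G r v t).history = Action.output o

/-- The set of all nodes visited by the execution of `A` initiated at `v`. -/
def visitedSet (A : Algorithm L O) (G : LabeledGraph Δ α L) (r : G.RandomBits) (v : G.V) :
    Set G.V :=
  {u | ∃ t, u ∈ (exec A G r v t).visited}

/-- The distance cost of one execution. -/
noncomputable def dist (A : Algorithm L O) (G : LabeledGraph Δ α L) (r : G.RandomBits) (v : G.V) :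
    ℕ∞ :=
  ⨆ w ∈ A.visitedSet G r v, G.graph.edist v w

/-- The volume cost of one execution. -/
noncomputable def vol (A : Algorithm L O) (G : LabeledGraph Δ α L) (r : G.RandomBits) (v : G.V) :
    ℕ∞ :=
  (A.visitedSet G r v).encard

/-- The distance cost of `A` on labeled graphs with at most `n` nodes. The random strings count as
part of the input, so that this is a worst case over them, too. -/
noncomputable def distCost (Δ : ℕ) (α : ℝ) (A : Algorithm L O) (n : ℕ) : ℕ∞ :=
  ⨆ (G : LabeledGraph Δ α L) (_ : G.size ≤ n) (r : G.RandomBits) (v : G.V), A.dist G r v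

/-- The volume cost of `A` on labeled graphs with at most `n` nodes. -/
noncomputable def volCost (Δ : ℕ) (α : ℝ) (A : Algorithm L O) (n : ℕ) : ℕ∞ :=
  ⨆ (G : LabeledGraph Δ α L) (_ : G.size ≤ n) (r : G.RandomBits) (v : G.V), A.vol G r v

end Algorithm

/-! ## Graph problems and their complexities -/

/-- A graph problem: the set of valid outputs for every input. -/
abbrev GraphProblem (Δ : ℕ) (α : ℝ) (L O : Type) : Type 1 :=
  (G : LabeledGraph Δ α L) → Set (G.V → O)

namespace GraphProblem

variable {Δ : ℕ} {α : ℝ} {L O : Type}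

/-- With random bits `r`, the execution of `A` halts at every node of `G`, and the outputs form a
valid solution. -/
def Succeeds (P : GraphProblem Δ α L O) (A : Algorithm L O) (G : LabeledGraph Δ α L)
    (r : G.RandomBits) : Prop :=
  ∃ out : G.V → O, (∀ v, A.Outputs G r v (out v)) ∧ out ∈ P G

/-- The deterministic algorithms that solve `P`. -/
def detSolvers (P : GraphProblem Δ α L O) : Set (Algorithm L O) :=
  {A | A.IsDeterministic ∧ ∀ (G : LabeledGraph Δ α L) (r : G.RandomBits), P.Succeeds A G r}

/-- The randomized algorithms that solve `P` with failure probability at most `K / n` on graphs with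
`n` nodes, and that on each input read, with probability at least `1 - K / n`, at most some finite
number `b` of random bits. -/
def randSolvers (P : GraphProblem Δ α L O) (K : ℝ) : Set (Algorithm L O) :=
  {A | ∀ G : LabeledGraph Δ α L,
    G.bitMeasure {r | ¬ P.Succeeds A G r} ≤ ENNReal.ofReal (K / G.size) ∧
    ∃ b : ℕ, G.bitMeasure {r | ∃ v t, b < ∑ w, (A.exec G r v t).bitsRead w} ≤
      ENNReal.ofReal (K / G.size)}

/-- The deterministic complexity of `P` with respect to a cost measure: the infimum of the cost over
all deterministic algorithms that solve `P`. -/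
noncomputable def detComplexity (P : GraphProblem Δ α L O) (cost : Algorithm L O → ℕ → ℕ∞)
    (n : ℕ) : ℕ∞ :=
  ⨅ A ∈ P.detSolvers, cost A n

/-- The randomized complexity of `P` with respect to a cost measure, for failure probability
`K / n`. -/
noncomputable def randComplexity (P : GraphProblem Δ α L O) (K : ℝ)
    (cost : Algorithm L O → ℕ → ℕ∞) (n : ℕ) : ℕ∞ :=
  ⨅ A ∈ P.randSolvers K, cost A n

/-- The deterministic complexity of `P` is `Θ(f)`: it is at least `c * f n` for all large `n`, and
a single algorithm attains `C * f n` for all large `n`. -/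
def DetComplexityTheta (P : GraphProblem Δ α L O) (cost : Algorithm L O → ℕ → ℕ∞)
    (f : ℕ → ℝ) : Prop :=
  ∃ c C : ℝ, 0 < c ∧ 0 < C ∧
    (∀ᶠ n in Filter.atTop,
      ENNReal.ofReal (c * f n) ≤ ((P.detComplexity cost n : ℕ∞) : ENNReal)) ∧
    ∃ A ∈ P.detSolvers, ∀ᶠ n in Filter.atTop,
      ((cost A n : ℕ∞) : ENNReal) ≤ ENNReal.ofReal (C * f n)

/-- The randomized complexity of `P` is `Θ(f)`, whatever the constant `K` in the failure probability
`K / n`; the constants of `Θ` do not depend on `K`. -/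
def RandComplexityTheta (P : GraphProblem Δ α L O) (cost : Algorithm L O → ℕ → ℕ∞)
    (f : ℕ → ℝ) : Prop :=
  ∃ c C : ℝ, 0 < c ∧ 0 < C ∧ ∀ K : ℝ, 0 < K →
    (∀ᶠ n in Filter.atTop,
      ENNReal.ofReal (c * f n) ≤ ((P.randComplexity K cost n : ℕ∞) : ENNReal)) ∧
    ∃ A ∈ P.randSolvers K, ∀ᶠ n in Filter.atTop,
      ((cost A n : ℕ∞) : ENNReal) ≤ ENNReal.ofReal (C * f n)

end GraphProblem

/-! ## Leaf coloring -/

inductive Color : Type where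
  | red
  | blue

/-- A well-formed colored tree label: parent, left child and right child are ports or `⊥`
(`none`), and those that are not `⊥` are pairwise distinct. -/
structure ColoredTreeLabel (Δ : ℕ) : Type where
  parent : Option (Fin Δ)
  left : Option (Fin Δ)
  right : Option (Fin Δ)
  color : Color
  parent_ne_left : ∀ p, parent = some p → left ≠ some p
  parent_ne_right : ∀ p, parent = some p → right ≠ some p
  left_ne_right : ∀ p, left = some p → right ≠ some p

namespace LeafColoring

variable {Δ : ℕ} {α : ℝ}

/-- The node adjacent to `v` via a port given as a label. There is none if the label is `⊥` or is
not the number of a port of `v`. -/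
def follow (G : LabeledGraph Δ α (ColoredTreeLabel Δ)) (v : G.V) (p : Option (Fin Δ)) :
    Option G.V :=
  p.bind fun i => G.neighbor v i

def parent (G : LabeledGraph Δ α (ColoredTreeLabel Δ)) (v : G.V) : Option G.V :=
  follow G v (G.label v).parent

def left (G : LabeledGraph Δ α (ColoredTreeLabel Δ)) (v : G.V) : Option G.V :=
  follow G v (G.label v).left

def right (G : LabeledGraph Δ α (ColoredTreeLabel Δ)) (v : G.V) : Option G.V :=
  follow G v (G.label v).right

def IsInternal (G : LabeledGraph Δ α (ColoredTreeLabel Δ)) (v : G.V) : Prop :=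
  (∃ w, left G v = some w ∧ parent G w = some v) ∧
    ∃ w, right G v = some w ∧ parent G w = some v

def IsLeaf (G : LabeledGraph Δ α (ColoredTreeLabel Δ)) (v : G.V) : Prop :=
  (G.label v).left = none ∧ (G.label v).right = none ∧
    ∃ u, parent G v = some u ∧ IsInternal G u

def IsInconsistent (G : LabeledGraph Δ α (ColoredTreeLabel Δ)) (v : G.V) : Prop :=
  ¬ IsInternal G v ∧ ¬ IsLeaf G v

end LeafColoring

/-- The problem LeafColoring on graphs of maximum degree at most `Δ`. -/
def leafColoring (Δ : ℕ) (α : ℝ) : GraphProblem Δ α (ColoredTreeLabel Δ) Color := fun G =>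
  {out | ∀ v,
    (LeafColoring.IsLeaf G v ∨ LeafColoring.IsInconsistent G v → out v = (G.label v).color) ∧
    (LeafColoring.IsInternal G v →
      (∃ w, LeafColoring.left G v = some w ∧ out v = out w) ∨
      (∃ w, LeafColoring.right G v = some w ∧ out v = out w))}

end VolumeModel

/-!
For a node `v`, follow the child pointers of internal nodes. A child declares its parent, so the
child relation is a graph of in-degree at most one in which internal nodes have out-degree two;
distinct downward paths of the same length from the same node end in distinct nodes.

*Deterministic upper bound.* If all descendants of `v` at depth less than `k` are internal, then
there are `2 ^ k` descendants at depth `k` (`two_pow_le_card_of_nearest`). Hence some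
non-internal descendant lies at depth at most `log n`, and the color of the nearest one (ties
broken to the left) is a valid output (`nearest_mem_leafColoring`).

*Randomized upper bound.* Every node picks one of its children by its first random bit, which
defines a walk from every node. A node outputs the color of the end of its walk, and red if the
walk does not end within `T` steps. This is valid unless some walk ends after exactly `T + 1`
steps (`walkColor_mem_leafColoring`); walks caught in a cycle all output red. Walking back from the
end node `u` of such a walk prescribes the first bits of `T + 1` distinct ancestors of `u`, so that
the failure probability is at most `n * 2 ^ (-(T + 1))` (`bitMeasure_walkEndsAt_le`). A value of
`T` logarithmic in `n` suffices for every error bound `K / n`.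

*Lower bound `log n`.* The nodes of a complete binary tree of depth `d` with monochromatic leaves
have to output the color of the leaves. An execution from the root that stays at distance less than
`d` behaves in the same way for both colors, and if both failure probabilities are less than `1 / 2`
then some random string makes it succeed for both (`le_distCost_of_mem_randSolvers`).

*Lower bound `n`.* Against a deterministic algorithm that visits fewer than `n / 3` nodes, an
adversary answers each query of an unexplored child with a fresh internal node. The algorithm has to
halt when it has seen internal nodes only, and the partial tree can still be completed by leaves of
either color (`le_volCost_of_mem_detSolvers`).

The remaining bounds follow from these: the distance is at most the volume, the volume is at most
`n`, and a deterministic solver is a randomized solver.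
-/

namespace VolumeModel

/-! ### Programs and their executions -/

/-- A program: a well-founded decision tree whose inner nodes are queries and bit reads, branching
over the possible answers, and whose leaves carry a result. -/
inductive Prog (L O : Type) : Type where
  | ret (o : O)
  | query (w j : ℕ) (k : Answer L → Prog L O)
  | bit (w : ℕ) (k : Answer L → Prog L O)

namespace Prog

variable {Δ : ℕ} {α : ℝ} {L O O' : Type}

/-- Sequential composition: run `p`, then run `f` on its result. -/
def bind : Prog L O → (O → Prog L O') → Prog L O'
  | ret o, f => f o
  | query w j k, f => query w j fun a => (k a).bind f
  | bit w k, f => bit w fun a => (k a).bind f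

/-- The next action of a program after the given answers. -/
def next : Prog L O → List (Answer L) → Action O
  | ret o, _ => .output o
  | query w j _, [] => .query w j
  | query _ _ k, a :: h => (k a).next h
  | bit w _, [] => .readBit w
  | bit _ k, a :: h => (k a).next h

/-- A program without bit reads. -/
def IsDet : Prog L O → Prop
  | ret _ => True
  | query _ _ k => ∀ a, (k a).IsDet
  | bit _ _ => False

theorem IsDet.bind {p : Prog L O} {f : O → Prog L O'} (hp : p.IsDet) (hf : ∀ o, (f o).IsDet) :
    (p.bind f).IsDet := by
  induction p with
  | ret o => exact hf o
  | query w j k ih => exact fun a => ih a (hp a)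
  | bit w k _ => exact hp.elim

theorem IsDet.next_ne {p : Prog L O} (hp : p.IsDet) (h : List (Answer L)) (w : ℕ) :
    p.next h ≠ .readBit w := by
  induction p generalizing h with
  | ret o => simp [next]
  | query w j k ih =>
    cases h with
    | nil => simp [next]
    | cons a h => exact ih a (hp a) h
  | bit w k _ => exact hp.elim

/-- The algorithm that runs the program `p n i`, where `n` is the number of nodes and `i` the view
of the starting node. -/
def toAlgorithm (p : ℕ → NodeView L → Prog L O) : Algorithm L O where
  next n i h := (p n i).next h

/-- The answer to the query of port `j` of the node with identifier `w`, in the state `s`. -/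
def queryAnswer (G : LabeledGraph Δ α L) (s : ExecState G) (w j : ℕ) : Answer L :=
  match (s.visited.find? fun x => G.ident x == w).bind fun x => G.neighbor x j with
  | some u => .node (G.view u)
  | none => .invalid

/-- The answer to reading a bit of the node with identifier `w`, in the state `s`. -/
def bitAnswer (G : LabeledGraph Δ α L) (r : G.RandomBits) (s : ExecState G) (w : ℕ) : Answer L :=
  match s.visited.find? fun x => G.ident x == w with
  | some x => .bit (r (x, s.bitsRead x))
  | none => .invalid

theorem history_act_query (G : LabeledGraph Δ α L) (r : G.RandomBits) (s : ExecState G)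
    (w j : ℕ) : (Algorithm.act G r s (.query w j : Action O)).history =
      s.history ++ [queryAnswer G s w j] := by
  unfold Algorithm.act queryAnswer
  dsimp only
  split <;> simp only

theorem history_act_readBit (G : LabeledGraph Δ α L) (r : G.RandomBits) (s : ExecState G)
    (w : ℕ) : (Algorithm.act G r s (.readBit w : Action O)).history =
      s.history ++ [bitAnswer G r s w] := by
  unfold Algorithm.act bitAnswer
  dsimp only
  split <;> simp only

/-- The result and the final state of a program that is started in the state `s`. -/
def eval (G : LabeledGraph Δ α L) (r : G.RandomBits) :
    Prog L O → ExecState G → O × ExecState G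
  | ret o, s => (o, s)
  | query w j k, s =>
    eval G r (k (queryAnswer G s w j)) (Algorithm.act G r s (.query w j : Action O))
  | bit w k, s => eval G r (k (bitAnswer G r s w)) (Algorithm.act G r s (.readBit w : Action O))

theorem eval_bind (G : LabeledGraph Δ α L) (r : G.RandomBits) (p : Prog L O)
    (f : O → Prog L O') (s : ExecState G) :
    (p.bind f).eval G r s = (f (p.eval G r s).1).eval G r (p.eval G r s).2 := by
  induction p generalizing s with
  | ret o => rfl
  | query w j k ih => exact ih _ _
  | bit w k ih => exact ih _ _

end Prog

namespace Algorithm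

variable {Δ : ℕ} {α : ℝ} {L O : Type}

theorem exec_succ (A : Algorithm L O) (G : LabeledGraph Δ α L) (r : G.RandomBits) (v : G.V)
    (t : ℕ) : A.exec G r v (t + 1) =
      act G r (A.exec G r v t) (A.next G.size (G.view v) (A.exec G r v t).history) :=
  rfl

theorem visited_subset_act (G : LabeledGraph Δ α L) (r : G.RandomBits) (s : ExecState G)
    (a : Action O) : s.visited ⊆ (act G r s a).visited := by
  unfold act
  split
  · exact fun _ h => h
  · split
    · exact List.subset_cons_self _ _
    · exact fun _ h => h
  · split <;> exact fun _ h => h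

theorem bitsRead_le_act (G : LabeledGraph Δ α L) (r : G.RandomBits) (s : ExecState G)
    (a : Action O) (u : G.V) : s.bitsRead u ≤ (act G r s a).bitsRead u := by
  unfold act
  split
  · exact le_rfl
  · split <;> exact le_rfl
  · split
    · dsimp only
      split <;> omega
    · exact le_rfl

theorem exec_visited_mono (A : Algorithm L O) (G : LabeledGraph Δ α L) (r : G.RandomBits)
    (v : G.V) {t t' : ℕ} (h : t ≤ t') :
    (A.exec G r v t).visited ⊆ (A.exec G r v t').visited := by
  induction h with
  | refl => exact fun _ h => h
  | step _ ih => exact fun _ h => visited_subset_act _ _ _ _ (ih h)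

theorem exec_bitsRead_mono (A : Algorithm L O) (G : LabeledGraph Δ α L) (r : G.RandomBits)
    (v u : G.V) {t t' : ℕ} (h : t ≤ t') :
    (A.exec G r v t).bitsRead u ≤ (A.exec G r v t').bitsRead u := by
  induction h with
  | refl => exact le_rfl
  | step _ ih => exact ih.trans (bitsRead_le_act _ _ _ _ _)

theorem exec_eq_of_output (A : Algorithm L O) (G : LabeledGraph Δ α L) (r : G.RandomBits)
    (v : G.V) {t t' : ℕ} {o : O} (h : t ≤ t')
    (ho : A.next G.size (G.view v) (A.exec G r v t).history = .output o) :
    A.exec G r v t' = A.exec G r v t := by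
  induction h with
  | refl => rfl
  | step _ ih =>
    rw [exec_succ, ih, ho]
    rfl

theorem outputs_unique {A : Algorithm L O} {G : LabeledGraph Δ α L} {r : G.RandomBits}
    {v : G.V} {o o' : O} (h : A.Outputs G r v o) (h' : A.Outputs G r v o') : o = o' := by
  obtain ⟨t, ht⟩ := h
  obtain ⟨t', ht'⟩ := h'
  rcases le_total t t' with hle | hle
  · rw [exec_eq_of_output A G r v hle ht, ht] at ht'
    simpa using ht'
  · rw [exec_eq_of_output A G r v hle ht', ht'] at ht
    simpa using ht.symm

/-- If the remaining part of an execution is described by a program, then the execution reaches the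
final state of that program and outputs its result. -/
theorem exec_of_next_eq (A : Algorithm L O) (G : LabeledGraph Δ α L) (r : G.RandomBits) (v : G.V)
    (p : Prog L O) (t : ℕ)
    (h : ∀ l, A.next G.size (G.view v) ((A.exec G r v t).history ++ l) = p.next l) :
    ∃ t', A.exec G r v t' = (p.eval G r (A.exec G r v t)).2 ∧
      A.next G.size (G.view v) (A.exec G r v t').history =
        .output (p.eval G r (A.exec G r v t)).1 := by
  induction p generalizing t with
  | ret o => exact ⟨t, rfl, by simpa [Prog.next, Prog.eval] using h []⟩
  | query w j k ih =>
    have h0 : A.next G.size (G.view v) (A.exec G r v t).history = .query w j := by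
      simpa [Prog.next] using h []
    have h1 : A.exec G r v (t + 1) = act G r (A.exec G r v t) (.query w j : Action O) := by
      rw [exec_succ, h0]
    obtain ⟨t', ht'⟩ := ih (Prog.queryAnswer G (A.exec G r v t) w j) (t + 1) fun l => by
      rw [h1, Prog.history_act_query, List.append_assoc, h]
      rfl
    refine ⟨t', ?_⟩
    rwa [h1] at ht'
  | bit w k ih =>
    have h0 : A.next G.size (G.view v) (A.exec G r v t).history = .readBit w := by
      simpa [Prog.next] using h []
    have h1 : A.exec G r v (t + 1) = act G r (A.exec G r v t) (.readBit w : Action O) := by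
      rw [exec_succ, h0]
    obtain ⟨t', ht'⟩ := ih (Prog.bitAnswer G r (A.exec G r v t) w) (t + 1) fun l => by
      rw [h1, Prog.history_act_readBit, List.append_assoc, h]
      rfl
    refine ⟨t', ?_⟩
    rwa [h1] at ht'

end Algorithm

/-- The initial state of an execution from `v`. -/
def ExecState.init {Δ : ℕ} {α : ℝ} {L : Type} (G : LabeledGraph Δ α L) (v : G.V) : ExecState G where
  history := []
  visited := [v]
  bitsRead := fun _ => 0

namespace Prog

variable {Δ : ℕ} {α : ℝ} {L O : Type}

theorem exec_toAlgorithm (p : ℕ → NodeView L → Prog L O) (G : LabeledGraph Δ α L)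
    (r : G.RandomBits) (v : G.V) :
    ∃ t, (toAlgorithm p).exec G r v t =
        ((p G.size (G.view v)).eval G r (ExecState.init G v)).2 ∧
      (toAlgorithm p).next G.size (G.view v) ((toAlgorithm p).exec G r v t).history =
        .output ((p G.size (G.view v)).eval G r (ExecState.init G v)).1 :=
  Algorithm.exec_of_next_eq (toAlgorithm p) G r v (p G.size (G.view v)) 0 fun _ => rfl

theorem outputs_toAlgorithm (p : ℕ → NodeView L → Prog L O) (G : LabeledGraph Δ α L)
    (r : G.RandomBits) (v : G.V) :
    (toAlgorithm p).Outputs G r v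
      ((p G.size (G.view v)).eval G r (ExecState.init G v)).1 := by
  obtain ⟨t, -, ht⟩ := exec_toAlgorithm p G r v
  exact ⟨t, ht⟩

theorem mem_visited_of_mem_visitedSet (p : ℕ → NodeView L → Prog L O) (G : LabeledGraph Δ α L)
    (r : G.RandomBits) (v : G.V) {u : G.V} (hu : u ∈ (toAlgorithm p).visitedSet G r v) :
    u ∈ ((p G.size (G.view v)).eval G r (ExecState.init G v)).2.visited := by
  obtain ⟨t, ht, ho⟩ := exec_toAlgorithm p G r v
  obtain ⟨t', hu⟩ := hu
  rw [← ht, ← Algorithm.exec_eq_of_output _ G r v (le_max_left t t') ho]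
  exact Algorithm.exec_visited_mono _ _ _ _ (le_max_right t t') hu

theorem bitsRead_toAlgorithm_le (p : ℕ → NodeView L → Prog L O) (G : LabeledGraph Δ α L)
    (r : G.RandomBits) (v u : G.V) (t : ℕ) :
    ((toAlgorithm p).exec G r v t).bitsRead u ≤
      ((p G.size (G.view v)).eval G r (ExecState.init G v)).2.bitsRead u := by
  obtain ⟨t', ht, ho⟩ := exec_toAlgorithm p G r v
  rw [← ht, ← Algorithm.exec_eq_of_output _ G r v (le_max_left t' t) ho]
  exact Algorithm.exec_bitsRead_mono _ _ _ _ _ (le_max_right t' t)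

theorem isDeterministic_toAlgorithm {p : ℕ → NodeView L → Prog L O}
    (hp : ∀ n i, (p n i).IsDet) : (toAlgorithm p).IsDeterministic :=
  fun n i h w => (hp n i).next_ne h w

end Prog

/-! ### General relations between the complexity measures -/

namespace Algorithm

variable {Δ : ℕ} {α : ℝ} {L O : Type}

theorem exec_bitsRead_of_isDeterministic {A : Algorithm L O} (hA : A.IsDeterministic)
    (G : LabeledGraph Δ α L) (r : G.RandomBits) (v u : G.V) (t : ℕ) :
    (A.exec G r v t).bitsRead u = 0 := by
  induction t with
  | zero => rfl
  | succ t ih =>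
    rw [exec_succ]
    cases ha : A.next G.size (G.view v) (A.exec G r v t).history with
    | output o => exact ih
    | query w j =>
      unfold act
      dsimp only
      split <;> exact ih
    | readBit w => exact absurd ha (hA _ _ _ w)

theorem adj_of_neighbor_eq_some {G : LabeledGraph Δ α L} {v u : G.V} {j : ℕ}
    (h : G.neighbor v j = some u) : G.graph.Adj v u := by
  unfold LabeledGraph.neighbor at h
  split at h
  · rw [Option.some_inj] at h
    rw [← h]
    exact (G.port v _).2
  · simp at h

open Classical in
/-- Every visited node has been reached through visited nodes only, so that its distance is less
than their number. -/
theorem edist_lt_card_visited (A : Algorithm L O) (G : LabeledGraph Δ α L) (r : G.RandomBits)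
    (v : G.V) (t : ℕ) {u : G.V} (hu : u ∈ (A.exec G r v t).visited) :
    G.graph.edist v u + 1 ≤ ((A.exec G r v t).visited.toFinset.card : ℕ∞) := by
  induction t generalizing u with
  | zero =>
    have : u = v := by simpa [exec] using hu
    subst this
    simp [exec]
  | succ t ih =>
    have hsub : (A.exec G r v t).visited.toFinset.card ≤
        (A.exec G r v (t + 1)).visited.toFinset.card :=
      Finset.card_le_card fun x hx => by
        rw [List.mem_toFinset] at hx ⊢
        exact exec_visited_mono A G r v t.le_succ hx
    by_cases hold : u ∈ (A.exec G r v t).visited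
    · exact (ih hold).trans (by exact_mod_cast hsub)
    rw [exec_succ] at hu ⊢
    generalize A.next G.size (G.view v) (A.exec G r v t).history = a at hu ⊢
    unfold act at hu ⊢
    split at hu
    · exact absurd hu hold
    · rename_i w j
      split at hu
      · rename_i x hx
        obtain ⟨y, hy, hxy⟩ := Option.bind_eq_some_iff.1 hx
        have hux : u = x := by
          rcases List.mem_cons.1 hu with h | h
          · exact h
          · exact absurd h hold
        subst hux
        have hyv := ih (List.mem_of_find?_eq_some hy)
        have h1 : G.graph.edist v u ≤ G.graph.edist v y + 1 :=
          (SimpleGraph.edist_triangle (v := y)).trans (by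
            gcongr
            exact (SimpleGraph.edist_eq_one_iff_adj.2 (adj_of_neighbor_eq_some hxy)).le)
        rw [List.toFinset_cons, Finset.card_insert_of_notMem (by simpa using hold)]
        push_cast
        gcongr
        exact h1.trans hyv
      · exact absurd hu hold
    · split at hu <;> exact absurd hu hold

theorem dist_le_vol (A : Algorithm L O) (G : LabeledGraph Δ α L) (r : G.RandomBits) (v : G.V) :
    A.dist G r v ≤ A.vol G r v := by
  classical
  refine iSup₂_le fun u hu => ?_
  obtain ⟨t, ht⟩ := hu
  refine (le_self_add.trans (edist_lt_card_visited A G r v t ht)).trans ?_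
  rw [← Set.encard_coe_eq_coe_finsetCard]
  exact Set.encard_le_encard fun x hx => ⟨t, by simpa using hx⟩

theorem distCost_le_volCost (A : Algorithm L O) (n : ℕ) :
    A.distCost Δ α n ≤ A.volCost Δ α n := by
  refine iSup_mono fun G => iSup_mono fun _ => iSup_mono fun r => iSup_mono fun v => ?_
  exact dist_le_vol A G r v

theorem volCost_le (A : Algorithm L O) (n : ℕ) : A.volCost Δ α n ≤ n := by
  refine iSup_le fun G => iSup_le fun hG => iSup_le fun r => iSup_le fun v => ?_
  refine (Set.encard_le_encard (Set.subset_univ _)).trans ?_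
  rw [Set.encard_univ, ENat.card_eq_coe_fintype_card]
  exact_mod_cast hG

end Algorithm

theorem GraphProblem.detSolvers_subset_randSolvers {Δ : ℕ} {α : ℝ} {L O : Type}
    (P : GraphProblem Δ α L O) (K : ℝ) : P.detSolvers ⊆ P.randSolvers K := by
  rintro A ⟨hdet, hA⟩ G
  refine ⟨?_, 0, ?_⟩
  · simp [hA]
  · simp [Algorithm.exec_bitsRead_of_isDeterministic hdet]

/-! ### Local structure of the tree of internal nodes -/

namespace LeafColoring

variable {Δ : ℕ} {α : ℝ}

/-- The parent of `v`, or `v` itself if it has none. -/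
def par (G : LabeledGraph Δ α (ColoredTreeLabel Δ)) (v : G.V) : G.V := (parent G v).getD v

open Classical in
/-- The neighbor of `v` behind the port `p`, if it exists and declares `v` as its parent. -/
noncomputable def child (G : LabeledGraph Δ α (ColoredTreeLabel Δ)) (v : G.V)
    (p : Option (Fin Δ)) : Option G.V :=
  (follow G v p).filter fun y => parent G y = some v

/-- The two children of an internal node, and `none` for all other nodes. -/
noncomputable def kids (G : LabeledGraph Δ α (ColoredTreeLabel Δ)) (v : G.V) :
    Option (G.V × G.V) :=
  (child G v (G.label v).left).bind fun l => (child G v (G.label v).right).map fun x => (l, x)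

theorem child_eq_some {G : LabeledGraph Δ α (ColoredTreeLabel Δ)} {v y : G.V}
    {p : Option (Fin Δ)} :
    child G v p = some y ↔ follow G v p = some y ∧ parent G y = some v := by
  simp [child, Option.filter_eq_some_iff]

theorem kids_eq_some {G : LabeledGraph Δ α (ColoredTreeLabel Δ)} {v l x : G.V} :
    kids G v = some (l, x) ↔ (left G v = some l ∧ parent G l = some v) ∧
      (right G v = some x ∧ parent G x = some v) := by
  simp only [kids, Option.bind_eq_some_iff, Option.map_eq_some_iff, Prod.mk.injEq, child_eq_some]
  constructor
  · rintro ⟨l, hl, x, hx, rfl, rfl⟩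
    exact ⟨hl, hx⟩
  · rintro ⟨hl, hx⟩
    exact ⟨l, hl, x, hx, rfl, rfl⟩

theorem isInternal_iff {G : LabeledGraph Δ α (ColoredTreeLabel Δ)} {v : G.V} :
    IsInternal G v ↔ ∃ l x, kids G v = some (l, x) := by
  simp only [kids_eq_some]
  constructor
  · rintro ⟨⟨l, hl⟩, ⟨x, hx⟩⟩
    exact ⟨l, x, hl, hx⟩
  · rintro ⟨l, x, hl, hx⟩
    exact ⟨⟨l, hl⟩, ⟨x, hx⟩⟩

theorem kids_eq_none {G : LabeledGraph Δ α (ColoredTreeLabel Δ)} {v : G.V} :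
    kids G v = none ↔ ¬ IsInternal G v := by
  rw [isInternal_iff]
  rcases kids G v with _ | ⟨l, x⟩ <;> simp

theorem left_ne_right {G : LabeledGraph Δ α (ColoredTreeLabel Δ)} {v l x : G.V}
    (hl : left G v = some l) (hx : right G v = some x) : l ≠ x := by
  rintro rfl
  unfold left follow at hl
  unfold right follow at hx
  obtain ⟨p, hp, hpl⟩ := Option.bind_eq_some_iff.1 hl
  obtain ⟨q, hq, hqx⟩ := Option.bind_eq_some_iff.1 hx
  unfold LabeledGraph.neighbor at hpl hqx
  split at hpl
  · split at hqx
    · rw [Option.some_inj] at hpl hqx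
      have := (G.port v).injective (Subtype.ext (hpl.trans hqx.symm))
      simp only [Fin.mk.injEq] at this
      exact (G.label v).left_ne_right p hp (by rw [hq, Fin.ext this])
    · simp at hqx
  · simp at hpl

theorem par_eq_of_parent {G : LabeledGraph Δ α (ColoredTreeLabel Δ)} {v y : G.V}
    (h : parent G y = some v) : par G y = v := by
  simp [par, h]

theorem edist_le_one_of_follow {G : LabeledGraph Δ α (ColoredTreeLabel Δ)} {v y : G.V}
    {p : Option (Fin Δ)} (h : follow G v p = some y) : G.graph.edist v y ≤ 1 := by
  obtain ⟨j, -, hj⟩ := Option.bind_eq_some_iff.1 h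
  exact (SimpleGraph.edist_eq_one_iff_adj.2 (Algorithm.adj_of_neighbor_eq_some hj)).le

/-- An output is valid as soon as non-internal nodes output their own color and every internal node
agrees with one of its children: the notion of leaf is irrelevant. -/
theorem mem_leafColoring_of {G : LabeledGraph Δ α (ColoredTreeLabel Δ)} {out : G.V → Color}
    (h0 : ∀ v, ¬ IsInternal G v → out v = (G.label v).color)
    (h1 : ∀ v l x, kids G v = some (l, x) → out v = out l ∨ out v = out x) :
    out ∈ leafColoring Δ α G := by
  intro v
  constructor
  · rintro (⟨hl, -, -⟩ | ⟨hv, -⟩)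
    · refine h0 v ?_
      rintro ⟨⟨w, hw, -⟩, -⟩
      simp [left, hl, follow] at hw
    · exact h0 v hv
  · intro hv
    obtain ⟨l, x, hk⟩ := isInternal_iff.1 hv
    obtain ⟨⟨hl, -⟩, ⟨hx, -⟩⟩ := kids_eq_some.1 hk
    exact (h1 v l x hk).imp (fun h => ⟨l, hl, h⟩) fun h => ⟨x, hx, h⟩

/-! ### Programs that inspect the neighborhood of a node -/

open Prog

/-- Visit the node behind the port `p` of the visited node with identifier `w`. -/
def probe (w : ℕ) : Option (Fin Δ) →
    Prog (ColoredTreeLabel Δ) (Option (NodeView (ColoredTreeLabel Δ)))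
  | none => ret none
  | some j => query w j fun
    | .node y => ret (some y)
    | _ => ret none

/-- Compute `child`. -/
def childProg (i : NodeView (ColoredTreeLabel Δ)) (p : Option (Fin Δ)) :
    Prog (ColoredTreeLabel Δ) (Option (NodeView (ColoredTreeLabel Δ))) :=
  (probe i.ident p).bind fun
    | none => ret none
    | some y => (probe y.ident y.label.parent).bind fun z =>
        ret (if z.map NodeView.ident = some i.ident then some y else none)

/-- Compute `kids`. -/
def kidsProg (i : NodeView (ColoredTreeLabel Δ)) :
    Prog (ColoredTreeLabel Δ)
      (Option (NodeView (ColoredTreeLabel Δ) × NodeView (ColoredTreeLabel Δ))) :=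
  (childProg i i.label.left).bind fun l => (childProg i i.label.right).bind fun x =>
    ret (l.bind fun l => x.map fun x => (l, x))

theorem isDet_probe (w : ℕ) (p : Option (Fin Δ)) : (probe w p).IsDet := by
  cases p with
  | none => trivial
  | some j => intro a; cases a <;> trivial

theorem isDet_childProg (i : NodeView (ColoredTreeLabel Δ)) (p : Option (Fin Δ)) :
    (childProg i p).IsDet := by
  refine (isDet_probe _ _).bind ?_
  rintro (_ | y)
  · trivial
  · exact (isDet_probe _ _).bind fun _ => trivial

theorem isDet_kidsProg (i : NodeView (ColoredTreeLabel Δ)) : (kidsProg i).IsDet :=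
  (isDet_childProg _ _).bind fun _ => (isDet_childProg _ _).bind fun _ => trivial

theorem find_visited {L : Type} {G : LabeledGraph Δ α L} {l : List G.V} {x : G.V} (hx : x ∈ l) :
    (l.find? fun y => G.ident y == G.ident x) = some x := by
  cases h : l.find? fun y => G.ident y == G.ident x with
  | none => simpa using List.find?_eq_none.1 h x hx
  | some y =>
    have := List.find?_some h
    have hyx : y = x := G.ident_injective (by simpa using this)
    rw [hyx]

theorem eval_probe {G : LabeledGraph Δ α (ColoredTreeLabel Δ)} (r : G.RandomBits)
    {s : ExecState G} {x : G.V} (hx : x ∈ s.visited) (p : Option (Fin Δ)) :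
    ((probe (G.view x).ident p).eval G r s).1 = (follow G x p).map G.view ∧
    ((probe (G.view x).ident p).eval G r s).2.visited = (follow G x p).toList ++ s.visited ∧
    ((probe (G.view x).ident p).eval G r s).2.bitsRead = s.bitsRead := by
  cases p with
  | none => simp [probe, eval, follow]
  | some j =>
    rw [show (G.view x).ident = G.ident x from rfl]
    simp only [probe, eval, follow, Option.bind_some, queryAnswer, find_visited hx,
      Algorithm.act]
    cases G.neighbor x j <;> simp [eval]

theorem eval_childProg {G : LabeledGraph Δ α (ColoredTreeLabel Δ)} (r : G.RandomBits)
    {s : ExecState G} {x : G.V} (hx : x ∈ s.visited) (p : Option (Fin Δ)) :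
    ((childProg (G.view x) p).eval G r s).1 = (child G x p).map G.view ∧
    (∃ l, ((childProg (G.view x) p).eval G r s).2.visited = l ++ s.visited ∧ l.length ≤ 2 ∧
      (∀ u ∈ l, G.graph.edist x u ≤ 2) ∧ ∀ y, child G x p = some y → y ∈ l) ∧
    ((childProg (G.view x) p).eval G r s).2.bitsRead = s.bitsRead := by
  obtain ⟨h1, h2, h3⟩ := eval_probe r hx p
  rw [childProg, eval_bind]
  rw [h1]
  generalize (eval G r (probe (G.view x).ident p) s).2 = s1 at h2 h3
  cases hf : follow G x p with
  | none => exact ⟨by simp [eval, child, hf], ⟨[], by simpa [hf, eval] using h2, by simp, by simp,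
      by simp [child, hf]⟩, h3⟩
  | some y =>
    have hy : y ∈ s1.visited := by simp [h2, hf]
    obtain ⟨k1, k2, k3⟩ := eval_probe r hy (G.view y).label.parent
    have hxy := edist_le_one_of_follow hf
    simp only [Option.map_some, eval_bind]
    simp only [eval, k1, k2, k3, h2, h3, hf]
    refine ⟨?_, ⟨(follow G y (G.view y).label.parent).toList ++ [y], by simp, ?_, ?_, ?_⟩, trivial⟩
    · have : (follow G y (G.view y).label.parent).map G.ident = some (G.ident x) ↔
          parent G y = some x := by
        rw [← Option.map_some (f := G.ident), (Option.map_injective G.ident_injective).eq_iff]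
        rfl
      rw [Option.map_map]
      change (if (follow G y (G.view y).label.parent).map G.ident = some (G.ident x) then _ else _)
        = _
      by_cases hp : parent G y = some x
      · rw [if_pos (this.2 hp), child_eq_some.2 ⟨hf, hp⟩, Option.map_some]
      · rw [if_neg fun h => hp (this.1 h), child, hf]
        simp [hp]
    · cases follow G y (G.view y).label.parent <;> simp
    · intro u hu
      rw [List.mem_append, Option.mem_toList, List.mem_singleton] at hu
      rcases hu with hu | rfl
      · refine (SimpleGraph.edist_triangle (v := y)).trans ?_
        rw [← one_add_one_eq_two]
        exact add_le_add hxy (edist_le_one_of_follow hu)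
      · exact hxy.trans (by norm_num)
    · intro z hz
      rw [child_eq_some, hf] at hz
      simp [Option.some_inj.1 hz.1]

theorem eval_kidsProg {G : LabeledGraph Δ α (ColoredTreeLabel Δ)} (r : G.RandomBits)
    {s : ExecState G} {x : G.V} (hx : x ∈ s.visited) :
    ((kidsProg (G.view x)).eval G r s).1 = (kids G x).map (Prod.map G.view G.view) ∧
    (∃ l, ((kidsProg (G.view x)).eval G r s).2.visited = l ++ s.visited ∧ l.length ≤ 4 ∧
      (∀ u ∈ l, G.graph.edist x u ≤ 2) ∧
      ∀ y z, kids G x = some (y, z) → y ∈ l ∧ z ∈ l) ∧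
    ((kidsProg (G.view x)).eval G r s).2.bitsRead = s.bitsRead := by
  obtain ⟨h1, ⟨l, h2, hl, hd, hm⟩, h3⟩ := eval_childProg r hx (G.label x).left
  rw [kidsProg, eval_bind, eval_bind]
  simp only [eval]
  change (eval G r (childProg (G.view x) (G.view x).label.left) s).1 = _ at h1
  change (eval G r (childProg (G.view x) (G.view x).label.left) s).2.visited = _ at h2
  change (eval G r (childProg (G.view x) (G.view x).label.left) s).2.bitsRead = _ at h3
  rw [h1]
  generalize (eval G r (childProg (G.view x) (G.view x).label.left) s).2 = s1 at h2 h3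
  have hx1 : x ∈ s1.visited := by simp [h2, hx]
  obtain ⟨k1, ⟨l', k2, kl, kd, km⟩, k3⟩ := eval_childProg r hx1 (G.label x).right
  refine ⟨?_, ⟨l' ++ l, ?_, ?_, ?_, ?_⟩, k3.trans h3⟩
  · change (Option.bind _ fun _ =>
      Option.map _ (eval G r (childProg (G.view x) (G.label x).right) s1).1) = _
    rw [k1, kids]
    change Option.bind _ (fun _ => Option.map _ (Option.map _ _)) = _
    cases child G x (G.label x).left <;> cases child G x (G.label x).right <;> simp
  · change (eval G r (childProg (G.view x) (G.label x).right) s1).2.visited = _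
    rw [k2, h2, List.append_assoc]
  · simp only [List.length_append]
    omega
  · intro u hu
    exact (List.mem_append.1 hu).elim (kd u) (hd u)
  · intro y z hyz
    obtain ⟨hy, hz⟩ := kids_eq_some.1 hyz
    exact ⟨List.mem_append_right _ (hm y (child_eq_some.2 hy)),
      List.mem_append_left _ (km z (child_eq_some.2 hz))⟩

/-! ### The deterministic algorithm -/

/-- Search for the nearest non-internal descendant of `v`, up to depth `k`; ties are broken in
favor of the left child. The result is the depth of the node found and its color; the search
stops at depth `k` even if the node there is internal. -/
noncomputable def nearest (G : LabeledGraph Δ α (ColoredTreeLabel Δ)) : ℕ → G.V → ℕ × Color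
  | 0, v => (0, (G.label v).color)
  | k + 1, v =>
    match kids G v with
    | none => (0, (G.label v).color)
    | some (l, x) =>
      if (nearest G k l).1 ≤ (nearest G k x).1 then ((nearest G k l).1 + 1, (nearest G k l).2)
      else ((nearest G k x).1 + 1, (nearest G k x).2)

theorem nearest_of_not_isInternal {G : LabeledGraph Δ α (ColoredTreeLabel Δ)} {v : G.V}
    (hv : ¬ IsInternal G v) (k : ℕ) : nearest G k v = (0, (G.label v).color) := by
  cases k with
  | zero => rfl
  | succ k => rw [nearest, kids_eq_none.2 hv]

/-- If the search does not fail at depth `k`, then a deeper search has the same result. -/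
theorem nearest_succ {G : LabeledGraph Δ α (ColoredTreeLabel Δ)} (k : ℕ) (v : G.V) :
    ((nearest G k v).1 < k → nearest G (k + 1) v = nearest G k v) ∧
      (k ≤ (nearest G k v).1 → k ≤ (nearest G (k + 1) v).1) := by
  induction k generalizing v with
  | zero => simp
  | succ k ih =>
    cases hk : kids G v with
    | none => simp [nearest, hk]
    | some p =>
      obtain ⟨l, x⟩ := p
      obtain ⟨l1, l2⟩ := ih l
      obtain ⟨x1, x2⟩ := ih x
      rw [nearest.eq_def G (k + 1 + 1), nearest.eq_def G (k + 1) v]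
      simp only [hk]
      grind

/-- If the search from `v` fails at depth `k`, then `v` has `2 ^ k` descendants at depth `k`. -/
theorem two_pow_le_card_of_nearest (G : LabeledGraph Δ α (ColoredTreeLabel Δ)) [DecidableEq G.V]
    (k : ℕ) (v : G.V) (h : k ≤ (nearest G k v).1) :
    2 ^ k ≤ (Finset.univ.filter fun u => (par G)^[k] u = v).card := by
  induction k generalizing v with
  | zero =>
    rw [pow_zero, Nat.one_le_iff_ne_zero, Finset.card_ne_zero]
    exact ⟨v, Finset.mem_filter.2 ⟨Finset.mem_univ _, rfl⟩⟩
  | succ k ih =>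
    cases hk : kids G v with
    | none => simp [nearest, hk] at h
    | some p =>
      obtain ⟨l, x⟩ := p
      rw [nearest, hk] at h
      obtain ⟨⟨hl, hpl⟩, ⟨hx, hpx⟩⟩ := kids_eq_some.1 hk
      have hl' := ih l (by dsimp only at h; split at h <;> simp only at h <;> omega)
      have hx' := ih x (by dsimp only at h; split at h <;> simp only at h <;> omega)
      have hdisj : Disjoint (Finset.univ.filter fun u => (par G)^[k] u = l)
          (Finset.univ.filter fun u => (par G)^[k] u = x) := by
        rw [Finset.disjoint_filter]
        rintro u - h1 h2
        exact left_ne_right hl hx (h1.symm.trans h2)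
      calc 2 ^ (k + 1) ≤ _ := by rw [pow_succ, mul_two]; exact add_le_add hl' hx'
        _ = _ := (Finset.card_union_of_disjoint hdisj).symm
        _ ≤ _ := Finset.card_le_card fun u hu => by
          simp only [Finset.mem_union, Finset.mem_filter, Finset.mem_univ, true_and] at hu ⊢
          rw [Function.iterate_succ_apply']
          rcases hu with hu | hu
          · rw [hu, par_eq_of_parent hpl]
          · rw [hu, par_eq_of_parent hpx]

theorem nearest_mem_leafColoring (G : LabeledGraph Δ α (ColoredTreeLabel Δ)) {k : ℕ}
    (hk : G.size < 2 ^ k) : (fun v => (nearest G k v).2) ∈ leafColoring Δ α G := by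
  classical
  have hlt : ∀ v, (nearest G k v).1 < k := by
    intro v
    by_contra! h
    exact absurd (two_pow_le_card_of_nearest G k v h)
      (not_le.2 ((Finset.card_le_univ _).trans_lt hk))
  refine mem_leafColoring_of (fun v hv => by rw [nearest_of_not_isInternal hv]) ?_
  intro v l x hkids
  rw [← (nearest_succ k v).1 (hlt v), nearest, hkids]
  dsimp only
  split
  · exact Or.inl rfl
  · exact Or.inr rfl

/-- Compute `nearest`. -/
def nearestProg : ℕ → NodeView (ColoredTreeLabel Δ) → Prog (ColoredTreeLabel Δ) (ℕ × Color)
  | 0, i => ret (0, i.label.color)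
  | k + 1, i => (kidsProg i).bind fun
    | none => ret (0, i.label.color)
    | some (l, x) => (nearestProg k l).bind fun a => (nearestProg k x).bind fun b =>
        ret (if a.1 ≤ b.1 then (a.1 + 1, a.2) else (b.1 + 1, b.2))

theorem isDet_nearestProg (k : ℕ) (i : NodeView (ColoredTreeLabel Δ)) :
    (nearestProg k i).IsDet := by
  induction k generalizing i with
  | zero => trivial
  | succ k ih =>
    refine (isDet_kidsProg i).bind ?_
    rintro (_ | ⟨l, x⟩)
    · trivial
    · exact (ih l).bind fun _ => (ih x).bind fun _ => trivial

theorem eval_nearestProg {G : LabeledGraph Δ α (ColoredTreeLabel Δ)} (r : G.RandomBits) (k : ℕ)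
    {s : ExecState G} {x : G.V} (hx : x ∈ s.visited) :
    ((nearestProg k (G.view x)).eval G r s).1 = nearest G k x ∧
    s.visited ⊆ ((nearestProg k (G.view x)).eval G r s).2.visited ∧
    ∀ u ∈ ((nearestProg k (G.view x)).eval G r s).2.visited,
      u ∈ s.visited ∨ G.graph.edist x u ≤ (k + 1 : ℕ) := by
  induction k generalizing s x with
  | zero => exact ⟨rfl, fun _ h => h, fun _ h => Or.inl h⟩
  | succ k ih =>
    obtain ⟨h1, ⟨l, h2, -, hd, hm⟩, -⟩ := eval_kidsProg r hx
    rw [nearestProg, eval_bind, h1]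
    generalize ((kidsProg (G.view x)).eval G r s).2 = s1 at h2
    have hs1 : ∀ u ∈ s1.visited, u ∈ s.visited ∨ G.graph.edist x u ≤ (k + 1 + 1 : ℕ) := by
      intro u hu
      rw [h2, List.mem_append] at hu
      refine hu.symm.imp_right fun h => (hd u h).trans ?_
      exact_mod_cast (by omega : 2 ≤ k + 1 + 1)
    have hsub : s.visited ⊆ s1.visited := by rw [h2]; exact List.subset_append_right _ _
    cases hk : kids G x with
    | none => exact ⟨by simp [eval, nearest, hk, LabeledGraph.view], hsub, hs1⟩
    | some p =>
      obtain ⟨y, z⟩ := p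
      obtain ⟨hy, hz⟩ := hm y z hk
      obtain ⟨⟨hly, -⟩, ⟨hrz, -⟩⟩ := kids_eq_some.1 hk
      have hy1 : y ∈ s1.visited := by rw [h2]; exact List.mem_append_left _ hy
      have hz1 : z ∈ s1.visited := by rw [h2]; exact List.mem_append_left _ hz
      obtain ⟨a1, a2, a3⟩ := ih hy1
      simp only [Option.map_some, Prod.map, eval_bind, eval]
      rw [a1]
      generalize ((nearestProg k (G.view y)).eval G r s1).2 = s2 at a2 a3
      obtain ⟨b1, b2, b3⟩ := ih (a2 hz1)
      rw [b1]
      have hstep : ∀ w u, G.graph.edist x w ≤ 1 → G.graph.edist w u ≤ (k + 1 : ℕ) →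
          G.graph.edist x u ≤ (k + 1 + 1 : ℕ) := by
        intro w u hw hu
        refine (SimpleGraph.edist_triangle (v := w)).trans ((add_le_add hw hu).trans ?_)
        push_cast
        rw [add_comm]
      refine ⟨by simp [nearest, hk], fun _ h => b2 (a2 (hsub h)), fun u hu => ?_⟩
      rcases b3 u hu with hu | hu
      · rcases a3 u hu with hu | hu
        · exact hs1 u hu
        · exact Or.inr (hstep y u (edist_le_one_of_follow hly) hu)
      · exact Or.inr (hstep z u (edist_le_one_of_follow hrz) hu)

/-- The deterministic algorithm: output the color of the nearest non-internal descendant. -/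
def nearestAlgorithm (Δ : ℕ) : Algorithm (ColoredTreeLabel Δ) Color :=
  toAlgorithm fun n i => (nearestProg (Nat.log 2 n + 1) i).bind fun a => ret a.2

theorem nearestAlgorithm_mem_detSolvers (Δ : ℕ) (α : ℝ) :
    nearestAlgorithm Δ ∈ (leafColoring Δ α).detSolvers := by
  refine ⟨isDeterministic_toAlgorithm fun n i => (isDet_nearestProg _ _).bind fun _ => trivial,
    fun G r => ⟨fun v => (nearest G (Nat.log 2 G.size + 1) v).2, fun v => ?_,
      nearest_mem_leafColoring G (Nat.lt_pow_succ_log_self one_lt_two _)⟩⟩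
  have := outputs_toAlgorithm
    (fun n i => (nearestProg (Δ := Δ) (Nat.log 2 n + 1) i).bind fun a => ret a.2) G r v
  rw [eval_bind, (eval_nearestProg r _ (List.mem_singleton_self v :
    v ∈ (ExecState.init G v).visited)).1] at this
  exact this

theorem distCost_nearestAlgorithm_le (Δ : ℕ) (α : ℝ) (n : ℕ) :
    (nearestAlgorithm Δ).distCost Δ α n ≤ (Nat.log 2 n + 2 : ℕ) := by
  refine iSup_le fun G => iSup_le fun hG => iSup_le fun r => iSup_le fun v =>
    iSup₂_le fun u hu => ?_
  have := mem_visited_of_mem_visitedSet _ G r v hu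
  rw [eval_bind] at this
  rcases (eval_nearestProg r _ (List.mem_singleton_self v :
    v ∈ (ExecState.init G v).visited)).2.2 u this with h | h
  · rw [List.mem_singleton.1 h, SimpleGraph.edist_self]
    exact zero_le
  · refine h.trans ?_
    have := Nat.log_mono_right (b := 2) hG
    exact_mod_cast (by omega : Nat.log 2 G.size + 1 + 1 ≤ Nat.log 2 n + 2)

end LeafColoring

/-! ### The randomized algorithm -/

namespace LeafColoring

open Prog

variable {Δ : ℕ} {α : ℝ}

/-- The child of an internal node `v` chosen by the first random bit of `v`; all other nodes are
fixed. -/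
noncomputable def nx (G : LabeledGraph Δ α (ColoredTreeLabel Δ)) (r : G.RandomBits) (v : G.V) :
    G.V :=
  match kids G v with
  | none => v
  | some (l, x) => if r (v, 0) then l else x

open Classical in
/-- The color of the end of the random walk of at most `T` steps from `v`. It is red if the walk
does not end within `T` steps. -/
noncomputable def walkColor (G : LabeledGraph Δ α (ColoredTreeLabel Δ)) (r : G.RandomBits) (T : ℕ)
    (v : G.V) : Color :=
  if IsInternal G ((nx G r)^[T] v) then .red else (G.label ((nx G r)^[T] v)).color

theorem nx_of_not_isInternal {G : LabeledGraph Δ α (ColoredTreeLabel Δ)} (r : G.RandomBits)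
    {v : G.V} (hv : ¬ IsInternal G v) : nx G r v = v := by
  rw [nx, kids_eq_none.2 hv]

theorem par_nx {G : LabeledGraph Δ α (ColoredTreeLabel Δ)} (r : G.RandomBits) {v : G.V}
    (hv : IsInternal G v) : par G (nx G r v) = v := by
  obtain ⟨l, x, hk⟩ := isInternal_iff.1 hv
  obtain ⟨⟨-, hl⟩, ⟨-, hx⟩⟩ := kids_eq_some.1 hk
  rw [nx, hk]
  dsimp only
  split
  · exact par_eq_of_parent hl
  · exact par_eq_of_parent hx

theorem bit_eq_of_nx_eq {G : LabeledGraph Δ α (ColoredTreeLabel Δ)} {r r' : G.RandomBits} {v : G.V}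
    (hv : IsInternal G v) (h : nx G r v = nx G r' v) : r (v, 0) = r' (v, 0) := by
  obtain ⟨l, x, hk⟩ := isInternal_iff.1 hv
  obtain ⟨⟨hl, -⟩, ⟨hx, -⟩⟩ := kids_eq_some.1 hk
  have hne := left_ne_right hl hx
  simp only [nx, hk] at h
  cases h1 : r (v, 0) <;> cases h2 : r' (v, 0) <;> simp_all

theorem iterate_nx_eq {G : LabeledGraph Δ α (ColoredTreeLabel Δ)} {r : G.RandomBits} {v : G.V}
    {T k : ℕ} (h : ¬ IsInternal G ((nx G r)^[T] v)) (hk : T ≤ k) :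
    (nx G r)^[k] v = (nx G r)^[T] v := by
  obtain ⟨j, rfl⟩ := Nat.exists_eq_add_of_le' hk
  rw [Function.iterate_add_apply]
  exact Function.iterate_fixed (nx_of_not_isInternal r h) j

/-- A walk that returns to an internal node never ends. -/
theorem isInternal_iterate_nx_of_periodic {G : LabeledGraph Δ α (ColoredTreeLabel Δ)}
    {r : G.RandomBits} {v : G.V} (hv : IsInternal G v) {i : ℕ} (hi : (nx G r)^[i + 1] v = v)
    (T : ℕ) : IsInternal G ((nx G r)^[T] v) := by
  by_contra h
  have h1 := iterate_nx_eq h (Nat.le_mul_of_pos_left T i.succ_pos)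
  rw [Function.iterate_mul, Function.iterate_fixed hi] at h1
  exact h (h1 ▸ hv)

/-- Compute `walkColor`. The list `path` contains the identifiers of the nodes visited by the walk
so far. A walk that meets one of them again would never end, and the first random bit of that node
has already been read. -/
def walkProg : ℕ → List ℕ → NodeView (ColoredTreeLabel Δ) → Prog (ColoredTreeLabel Δ) Color
  | 0, _, i => (kidsProg i).bind fun
    | none => ret i.label.color
    | some _ => ret .red
  | T + 1, path, i => (kidsProg i).bind fun
    | none => ret i.label.color
    | some (l, x) => bit i.ident fun
      | .bit true => if l.ident ∈ i.ident :: path then ret .red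
          else walkProg T (i.ident :: path) l
      | _ => if x.ident ∈ i.ident :: path then ret .red
          else walkProg T (i.ident :: path) x

/-- The hypotheses on `path` form the invariant of the walk: all its nodes lead to the current node
`x`, and only their bits have been read, each of them at most once. -/
theorem eval_walkProg {G : LabeledGraph Δ α (ColoredTreeLabel Δ)} (r : G.RandomBits) (T : ℕ)
    {path : List G.V} {s : ExecState G} {x : G.V} (hx : x ∈ s.visited) (hxp : x ∉ path)
    (hpath : ∀ p ∈ path, ∃ i, (nx G r)^[i] p = x)
    (hbit : ∀ u, s.bitsRead u ≤ 1) (hbit0 : ∀ u ∉ path, s.bitsRead u = 0) :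
    ((walkProg T (path.map G.ident) (G.view x)).eval G r s).1 = walkColor G r T x ∧
    ((walkProg T (path.map G.ident) (G.view x)).eval G r s).2.visited.length ≤
      s.visited.length + 4 * (T + 1) ∧
    ∀ u, ((walkProg T (path.map G.ident) (G.view x)).eval G r s).2.bitsRead u ≤ 1 := by
  induction T generalizing path s x with
  | zero =>
    obtain ⟨h1, ⟨l, h2, hl, -, -⟩, h3⟩ := eval_kidsProg r hx
    rw [walkProg, eval_bind, h1]
    generalize ((kidsProg (G.view x)).eval G r s).2 = s1 at h2 h3
    have hlen : s1.visited.length ≤ s.visited.length + 4 * (0 + 1) := by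
      rw [h2, List.length_append]
      omega
    cases hk : kids G x with
    | none =>
      exact ⟨by simp [eval, walkColor, kids_eq_none.1 hk, LabeledGraph.view], hlen,
        fun u => by simpa [eval, h3] using hbit u⟩
    | some p =>
      have : IsInternal G x := isInternal_iff.2 ⟨_, _, hk⟩
      exact ⟨by simp [eval, walkColor, this], hlen, fun u => by simpa [eval, h3] using hbit u⟩
  | succ T ih =>
    obtain ⟨h1, ⟨l, h2, hl, -, hm⟩, h3⟩ := eval_kidsProg r hx
    rw [walkProg, eval_bind, h1]
    generalize ((kidsProg (G.view x)).eval G r s).2 = s1 at h2 h3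
    have hlen : s1.visited.length ≤ s.visited.length + 4 := by
      rw [h2, List.length_append]
      omega
    cases hk : kids G x with
    | none =>
      have hx' := kids_eq_none.1 hk
      refine ⟨?_, hlen.trans (by omega), fun u => by simpa [eval, h3] using hbit u⟩
      simp only [Option.map_none, eval, walkColor]
      rw [iterate_nx_eq (T := 0) hx' (Nat.zero_le _), Function.iterate_zero, id, if_neg hx']
      rfl
    | some p =>
      obtain ⟨y, z⟩ := p
      have hx' : IsInternal G x := isInternal_iff.2 ⟨_, _, hk⟩
      obtain ⟨hy, hz⟩ := hm y z hk
      have hx1 : x ∈ s1.visited := by rw [h2]; exact List.mem_append_right _ hx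
      -- The state after reading the bit of `x`, and the chosen child `w`.
      have key : ∀ (s2 : ExecState G) (w : G.V), s2.visited = s1.visited →
          s2.bitsRead = (fun u => if G.ident u = G.ident x then s1.bitsRead u + 1
            else s1.bitsRead u) → w ∈ l → nx G r x = w →
          ((if (G.view w).ident ∈ (G.view x).ident :: path.map G.ident then ret .red
            else walkProg T ((G.view x).ident :: path.map G.ident) (G.view w) :
              Prog (ColoredTreeLabel Δ) Color).eval G r s2).1 = walkColor G r (T + 1) x ∧
          ((if (G.view w).ident ∈ (G.view x).ident :: path.map G.ident then ret .red
            else walkProg T ((G.view x).ident :: path.map G.ident) (G.view w) :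
              Prog (ColoredTreeLabel Δ) Color).eval G r s2).2.visited.length ≤
              s.visited.length + 4 * (T + 1 + 1) ∧
          ∀ u, ((if (G.view w).ident ∈ (G.view x).ident :: path.map G.ident then ret .red
            else walkProg T ((G.view x).ident :: path.map G.ident) (G.view w) :
              Prog (ColoredTreeLabel Δ) Color).eval G r s2).2.bitsRead u ≤ 1 := by
        intro s2 w hv hb hw hnx
        have hlen2 : s2.visited.length ≤ s.visited.length + 4 := by rw [hv]; exact hlen
        have hb1 : ∀ u, s2.bitsRead u ≤ 1 := by
          intro u
          rw [hb, h3]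
          dsimp only
          split
          · rename_i hu
            rw [G.ident_injective hu, hbit0 x hxp]
          · exact hbit u
        have hiter : walkColor G r (T + 1) x = walkColor G r T w := by
          rw [← hnx]
          rfl
        have hmap : (G.view x).ident :: path.map G.ident = (x :: path).map G.ident := rfl
        rw [hmap]
        have hiff : (G.view w).ident ∈ (x :: path).map G.ident ↔ w ∈ x :: path :=
          List.mem_map_of_injective G.ident_injective
        by_cases hwp : w ∈ x :: path
        · rw [if_pos (hiff.2 hwp)]
          refine ⟨?_, by simp only [eval]; omega, hb1⟩
          have : ∃ i, (nx G r)^[i] w = x := by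
            rcases List.mem_cons.1 hwp with h | h
            · exact ⟨0, h⟩
            · exact hpath w h
          obtain ⟨i, hi⟩ := this
          have := isInternal_iterate_nx_of_periodic (r := r) hx' (i := i)
            (by rw [Function.iterate_succ_apply, hnx, hi]) (T + 1)
          simp only [eval, walkColor, if_pos this]
        · rw [if_neg fun h => hwp (hiff.1 h)]
          have hih := ih (path := x :: path) (s := s2) (x := w)
            (by rw [hv, h2]; exact List.mem_append_left _ hw) hwp ?_ hb1 ?_
          · exact ⟨hih.1.trans hiter.symm, hih.2.1.trans (by omega), hih.2.2⟩
          · intro p hp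
            rcases List.mem_cons.1 hp with rfl | hp
            · exact ⟨1, hnx⟩
            · obtain ⟨i, hi⟩ := hpath p hp
              exact ⟨i + 1, by rw [Function.iterate_succ_apply', hi, hnx]⟩
          · intro u hu
            rw [List.mem_cons, not_or] at hu
            rw [hb, h3]
            dsimp only
            rw [if_neg fun h => hu.1 (G.ident_injective h), hbit0 u hu.2]
      have hb0 : s1.bitsRead x = 0 := by rw [h3, hbit0 x hxp]
      simp only [Option.map_some, Prod.map, eval]
      have hans : bitAnswer G r s1 (G.view x).ident = .bit (r (x, 0)) := by
        rw [bitAnswer, show (G.view x).ident = G.ident x from rfl, find_visited hx1]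
        simp only [hb0]
      rw [hans]
      have hv2 : (Algorithm.act G r s1 (.readBit (G.view x).ident : Action Color)).visited =
          s1.visited := by
        rw [Algorithm.act, show (G.view x).ident = G.ident x from rfl, find_visited hx1]
      have hb2 : (Algorithm.act G r s1 (.readBit (G.view x).ident : Action Color)).bitsRead =
          fun u => if G.ident u = G.ident x then s1.bitsRead u + 1 else s1.bitsRead u := by
        rw [Algorithm.act, show (G.view x).ident = G.ident x from rfl, find_visited hx1]
      cases hr : r (x, 0) with
      | true => exact key _ y hv2 hb2 hy (by simp [nx, hk, hr])
      | false => exact key _ z hv2 hb2 hz (by simp [nx, hk, hr])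

/-- If no walk ends after exactly `T + 1` steps, then the walks of at most `T` steps give a valid
output. Walks that never end do no harm: they form cycles, on which the output is constant. -/
theorem walkColor_mem_leafColoring {G : LabeledGraph Δ α (ColoredTreeLabel Δ)} {r : G.RandomBits}
    {T : ℕ} (h : ∀ v, IsInternal G ((nx G r)^[T] v) → IsInternal G ((nx G r)^[T + 1] v)) :
    walkColor G r T ∈ leafColoring Δ α G := by
  refine mem_leafColoring_of (fun v hv => ?_) fun v l x hk => ?_
  · rw [walkColor, iterate_nx_eq (T := 0) hv (Nat.zero_le _)]
    exact if_neg hv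
  · have hnx : nx G r v = l ∨ nx G r v = x := by
      simp only [nx, hk]
      split
      · exact Or.inl rfl
      · exact Or.inr rfl
    have heq : walkColor G r T v = walkColor G r T (nx G r v) := by
      have hstep : (nx G r)^[T] (nx G r v) = (nx G r)^[T + 1] v := rfl
      unfold walkColor
      rw [hstep]
      by_cases hT : IsInternal G ((nx G r)^[T] v)
      · rw [if_pos hT, if_pos (h v hT)]
      · rw [iterate_nx_eq hT T.le_succ]
    rcases hnx with hnx | hnx
    · exact Or.inl (hnx ▸ heq)
    · exact Or.inr (hnx ▸ heq)

/-! ### Failure probability of the randomized algorithm -/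

instance isProbabilityMeasure_bitMeasure {L : Type} (G : LabeledGraph Δ α L) :
    MeasureTheory.IsProbabilityMeasure G.bitMeasure := by
  unfold LabeledGraph.bitMeasure
  infer_instance

/-- An event that determines the first bits of `k` nodes has probability at most `2 ^ (-k)`. -/
theorem bitMeasure_le_of_eq {L : Type} (G : LabeledGraph Δ α L) (S : Finset G.V)
    (E : Set G.RandomBits) (hE : ∀ r ∈ E, ∀ r' ∈ E, ∀ x ∈ S, r (x, 0) = r' (x, 0)) :
    G.bitMeasure E ≤ (2⁻¹ : ENNReal) ^ S.card := by
  rcases E.eq_empty_or_nonempty with rfl | ⟨r0, hr0⟩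
  · simp
  have hsub : E ⊆ Set.pi (S.map ⟨fun x => (x, 0), Prod.mk_left_injective 0⟩ : Finset (G.V × ℕ))
      fun j => {r0 j} := by
    intro r hr j hj
    simp only [Finset.coe_map, Function.Embedding.coeFn_mk, Set.mem_image, Finset.mem_coe] at hj
    obtain ⟨x, hx, rfl⟩ := hj
    exact hE r hr r0 hr0 x hx
  refine (MeasureTheory.measure_mono hsub).trans ?_
  rw [LabeledGraph.bitMeasure, MeasureTheory.Measure.infinitePi_pi _ fun _ _ => .singleton _]
  simp

/-- The event that some walk ends in `u` after exactly `T + 1` steps. -/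
def walkEndsAt (G : LabeledGraph Δ α (ColoredTreeLabel Δ)) (T : ℕ) (u : G.V) :
    Set G.RandomBits :=
  {r | ∃ v, IsInternal G ((nx G r)^[T] v) ∧ ¬ IsInternal G ((nx G r)^[T + 1] v) ∧
    (nx G r)^[T + 1] v = u}

theorem isInternal_iterate_nx_of_le {G : LabeledGraph Δ α (ColoredTreeLabel Δ)} {r : G.RandomBits}
    {v : G.V} {i T : ℕ} (h : IsInternal G ((nx G r)^[T] v)) (hi : i ≤ T) :
    IsInternal G ((nx G r)^[i] v) := by
  by_contra hn
  rw [iterate_nx_eq hn hi] at h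
  exact hn h

theorem iterate_par_of_mem_walkEndsAt {G : LabeledGraph Δ α (ColoredTreeLabel Δ)} {r : G.RandomBits}
    {v : G.V} {T : ℕ} (h : IsInternal G ((nx G r)^[T] v)) {j : ℕ} (hj : j ≤ T + 1) :
    (par G)^[j] ((nx G r)^[T + 1] v) = (nx G r)^[T + 1 - j] v := by
  induction j with
  | zero => rfl
  | succ j ih =>
    rw [Function.iterate_succ_apply', ih (by omega),
      show T + 1 - j = (T + 1 - (j + 1)) + 1 by omega, Function.iterate_succ_apply',
      par_nx r (isInternal_iterate_nx_of_le h (by omega))]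

/-- The nodes of a walk that ends after exactly `T + 1` steps are distinct. -/
theorem iterate_nx_injOn {G : LabeledGraph Δ α (ColoredTreeLabel Δ)} {r : G.RandomBits} {v : G.V}
    {T : ℕ} (h : IsInternal G ((nx G r)^[T] v)) (h' : ¬ IsInternal G ((nx G r)^[T + 1] v)) {i j : ℕ}
    (hij : i < j) (hj : j ≤ T) : (nx G r)^[i] v ≠ (nx G r)^[j] v := by
  intro heq
  refine h' ?_
  have : (nx G r)^[T + 1] v = (nx G r)^[T + 1 - j + i] v := by
    rw [Function.iterate_add_apply _ (T + 1 - j), heq, ← Function.iterate_add_apply, Nat.sub_add_cancel (by omega)]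
  rw [this]
  exact isInternal_iterate_nx_of_le h (by omega)

theorem bitMeasure_walkEndsAt_le (G : LabeledGraph Δ α (ColoredTreeLabel Δ)) (T : ℕ) (u : G.V) :
    G.bitMeasure (walkEndsAt G T u) ≤ (2⁻¹ : ENNReal) ^ (T + 1) := by
  classical
  rcases (walkEndsAt G T u).eq_empty_or_nonempty with hemp | ⟨r0, v0, hv0, hv0', hu0⟩
  · simp [hemp]
  have hcard : ((Finset.range (T + 1)).image fun j => (par G)^[j + 1] u).card = T + 1 := by
    rw [Finset.card_image_of_injOn, Finset.card_range]
    intro i hi j hj hij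
    simp only [Finset.coe_range, Set.mem_Iio] at hi hj
    dsimp only at hij
    rw [← hu0, iterate_par_of_mem_walkEndsAt hv0 (by omega),
      iterate_par_of_mem_walkEndsAt hv0 (by omega)] at hij
    rcases lt_trichotomy i j with hlt | rfl | hlt
    · exact absurd hij.symm (iterate_nx_injOn hv0 hv0' (by omega) (by omega))
    · rfl
    · exact absurd hij (iterate_nx_injOn hv0 hv0' (by omega) (by omega))
  refine (bitMeasure_le_of_eq G ((Finset.range (T + 1)).image fun j => (par G)^[j + 1] u) _
    ?_).trans_eq (by rw [hcard])
  have key : ∀ r ∈ walkEndsAt G T u, ∀ j < T + 1,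
      IsInternal G ((par G)^[j + 1] u) ∧ nx G r ((par G)^[j + 1] u) = (par G)^[j] u := by
    rintro r ⟨v, hv, -, rfl⟩ j hj
    rw [iterate_par_of_mem_walkEndsAt hv (by omega), iterate_par_of_mem_walkEndsAt hv (by omega)]
    refine ⟨isInternal_iterate_nx_of_le hv (by omega), ?_⟩
    rw [← Function.iterate_succ_apply' (nx G r)]
    congr 1
    omega
  intro r hr r' hr' x hx
  obtain ⟨j, hj, rfl⟩ := Finset.mem_image.1 hx
  obtain ⟨h1, h2⟩ := key r hr j (Finset.mem_range.1 hj)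
  obtain ⟨-, h3⟩ := key r' hr' j (Finset.mem_range.1 hj)
  exact bit_eq_of_nx_eq h1 (h2.trans h3.symm)

/-- The randomized algorithm: follow the random walk for at most `T = 2 * (log n + 1) + m` steps.
As `2 ^ T` is at least `n ^ 2 * 2 ^ m`, the failure probability `n * 2 ^ (-(T + 1))` is at most
`2 ^ (-m) / n`. -/
def walkAlgorithm (Δ m : ℕ) : Algorithm (ColoredTreeLabel Δ) Color :=
  toAlgorithm fun n i => walkProg (2 * (Nat.log 2 n + 1) + m) [] i

theorem walkAlgorithm_mem_randSolvers (Δ : ℕ) (α : ℝ) {m : ℕ} {K : ℝ} (hK : 0 < K)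
    (hm : 1 ≤ K * 2 ^ m) : walkAlgorithm Δ m ∈ (leafColoring Δ α).randSolvers K := by
  intro G
  have heval := fun (r : G.RandomBits) (v : G.V) =>
    eval_walkProg r (2 * (Nat.log 2 G.size + 1) + m) (path := [])
      (s := ExecState.init G v) (List.mem_singleton_self v : v ∈ (ExecState.init G v).visited) (by simp) (by simp)
      (fun u => Nat.zero_le 1) (fun _ _ => rfl)
  constructor
  · have hsub : {r | ¬ (leafColoring Δ α).Succeeds (walkAlgorithm Δ m) G r} ⊆
        ⋃ u, walkEndsAt G (2 * (Nat.log 2 G.size + 1) + m) u := by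
      intro r hr
      by_contra hn
      simp only [walkEndsAt, Set.mem_iUnion, Set.mem_ofPred_eq, not_exists, not_and] at hn
      refine hr ⟨walkColor G r (2 * (Nat.log 2 G.size + 1) + m), fun v => ?_,
        walkColor_mem_leafColoring fun v hv => ?_⟩
      · rw [← (heval r v).1]
        exact outputs_toAlgorithm
          (fun n i => walkProg (Δ := Δ) (2 * (Nat.log 2 n + 1) + m) [] i) G r v
      · by_contra hv'
        exact hn _ v hv hv' rfl
    refine (MeasureTheory.measure_mono hsub).trans ((MeasureTheory.measure_iUnion_fintype_le _ _).trans
      ((Finset.sum_le_sum fun u _ => bitMeasure_walkEndsAt_le G _ u).trans ?_))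
    rw [Finset.sum_const, Finset.card_univ, nsmul_eq_mul]
    change ((G.size : ℕ) : ENNReal) * _ ≤ _
    generalize G.size = n
    rcases Nat.eq_zero_or_pos n with rfl | hn
    · simp
    have h2 : (2⁻¹ : ENNReal) = ENNReal.ofReal (2⁻¹ : ℝ) := by
      rw [ENNReal.ofReal_inv_of_pos two_pos, ENNReal.ofReal_ofNat]
    rw [h2, ← ENNReal.ofReal_pow (by positivity), ← ENNReal.ofReal_natCast,
      ← ENNReal.ofReal_mul (by positivity)]
    refine ENNReal.ofReal_le_ofReal ?_
    have hn' : (0 : ℝ) < n := by exact_mod_cast hn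
    have hlog : (n : ℝ) ≤ 2 ^ (Nat.log 2 n + 1) := by
      exact_mod_cast (Nat.lt_pow_succ_log_self one_lt_two n).le
    rw [le_div_iff₀ hn', inv_pow, ← div_eq_mul_inv, div_mul_eq_mul_div,
      div_le_iff₀ (by positivity), pow_succ, pow_add, pow_mul']
    calc (n : ℝ) * n = 1 * (n ^ 2) := by ring
      _ ≤ (K * 2 ^ m) * (2 ^ (Nat.log 2 n + 1)) ^ 2 := by gcongr
      _ ≤ (K * 2 ^ m) * (2 ^ (Nat.log 2 n + 1)) ^ 2 * 2 :=
        le_mul_of_one_le_right (by positivity) one_le_two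
      _ = _ := by ring
  · -- Every execution reads at most one bit of every node.
    refine ⟨G.size, ?_⟩
    have : {r : G.RandomBits | ∃ v t,
        G.size < ∑ w, ((walkAlgorithm Δ m).exec G r v t).bitsRead w} = ∅ := by
      refine Set.eq_empty_iff_forall_notMem.2 ?_
      rintro r ⟨v, t, h⟩
      refine absurd h (not_lt.2 ?_)
      calc _ ≤ ∑ w : G.V, 1 := Finset.sum_le_sum fun w _ =>
            (bitsRead_toAlgorithm_le _ G r v w t).trans ((heval r v).2.2 w)
        _ = G.size := by simp [LabeledGraph.size]
    simp [this]

theorem volCost_walkAlgorithm_le (Δ : ℕ) (α : ℝ) (m n : ℕ) :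
    (walkAlgorithm Δ m).volCost Δ α n ≤ (8 * Nat.log 2 n + 4 * m + 13 : ℕ) := by
  classical
  refine iSup_le fun G => iSup_le fun hG => iSup_le fun r => iSup_le fun v => ?_
  have h := (eval_walkProg r (2 * (Nat.log 2 G.size + 1) + m) (path := [])
    (s := ExecState.init G v) (List.mem_singleton_self v : v ∈ (ExecState.init G v).visited) (by simp) (by simp)
    (fun u => Nat.zero_le 1) (fun _ _ => rfl)).2.1
  have hsub : (walkAlgorithm Δ m).visitedSet G r v ⊆
      ((walkProg (2 * (Nat.log 2 G.size + 1) + m) ([].map G.ident) (G.view v)).eval G r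
        (ExecState.init G v)).2.visited.toFinset := fun u hu =>
    List.mem_toFinset.2 (mem_visited_of_mem_visitedSet _ G r v hu)
  refine (Set.encard_le_encard hsub).trans ?_
  rw [Set.encard_coe_eq_coe_finsetCard]
  have hlog := Nat.log_mono_right (b := 2) hG
  refine Nat.cast_le.2 ((List.toFinset_card_le _).trans (h.trans ?_))
  simp only [ExecState.init, List.length_singleton]
  omega

end LeafColoring

/-! ### Labeled binary forests -/

/-- A binary forest with node set `Fin N` whose internal nodes are `0, …, m - 1`: the children of
the internal node `i` are the larger numbers `ch i false` and `ch i true`. The values of `ch` at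
other nodes are irrelevant. -/
structure BinaryForest (N : ℕ) where
  m : ℕ
  ch : ℕ → Bool → ℕ
  lt_ch : ∀ i < m, ∀ b, i < ch i b
  ch_lt : ∀ i < m, ∀ b, ch i b < N
  inj : ∀ i < m, ∀ j < m, ∀ b b', ch i b = ch j b' → i = j ∧ b = b'

namespace BinaryForest

variable {N : ℕ} (S : BinaryForest N)

/-- The child of an internal node, as a node. -/
def childNode (v : Fin N) (h : v.val < S.m) (b : Bool) : Fin N := ⟨S.ch v b, S.ch_lt v h b⟩

open Classical in
/-- The internal node that has `v` as a child, if there is one. -/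
noncomputable def parentNode (v : Fin N) : Option (Fin N) :=
  if h : ∃ u : Fin N, u.val < S.m ∧ ∃ b, S.ch u b = v then some h.choose else none

variable {S}

theorem parentNode_eq_some {v u : Fin N} :
    S.parentNode v = some u ↔ u.val < S.m ∧ ∃ b, S.ch u b = v := by
  unfold parentNode
  split
  · rename_i h
    obtain ⟨h1, b, hb⟩ := h.choose_spec
    rw [Option.some_inj]
    constructor
    · rintro rfl
      exact ⟨h1, b, hb⟩
    · rintro ⟨hu, b', hb'⟩
      exact Fin.ext (S.inj _ h1 _ hu b b' (hb.trans hb'.symm)).1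
  · rename_i h
    simp only [reduceCtorEq, false_iff]
    exact fun hu => h ⟨u, hu⟩

variable (S)

/-- The neighbors of a node in the order of its ports: left child, right child, parent. -/
noncomputable def nbrs (v : Fin N) : List (Fin N) :=
  (if h : v.val < S.m then [S.childNode v h false, S.childNode v h true] else []) ++
    (S.parentNode v).toList

variable {S}

theorem mem_nbrs {v w : Fin N} : w ∈ S.nbrs v ↔
    (v.val < S.m ∧ ∃ b, S.ch v b = w) ∨ (w.val < S.m ∧ ∃ b, S.ch w b = v) := by
  unfold nbrs
  rw [List.mem_append, Option.mem_toList, parentNode_eq_some]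
  refine or_congr_left ?_
  split
  · rename_i h
    simp [childNode, Fin.ext_iff, h, eq_comm]
  · rename_i h
    simp [h]

theorem nodup_nbrs (v : Fin N) : (S.nbrs v).Nodup := by
  unfold nbrs
  rw [List.nodup_append]
  refine ⟨?_, ?_, ?_⟩
  · split
    · rename_i h
      have := S.inj v h v h false true
      simp only [childNode, List.nodup_cons, List.mem_singleton, Fin.mk.injEq, List.not_mem_nil,
        not_false_eq_true, List.nodup_nil, and_true]
      intro heq
      simpa using (this heq).2
    · exact List.nodup_nil
  · cases S.parentNode v <;> simp
  · intro a ha b hb hab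
    subst hab
    rw [Option.mem_toList, parentNode_eq_some] at hb
    obtain ⟨h1, b, hb⟩ := hb
    have hlt := S.lt_ch a h1 b
    split at ha
    · rename_i h
      have h3 := S.lt_ch v h false
      have h4 := S.lt_ch v h true
      rcases List.mem_cons.1 ha with rfl | ha
      · simp only [childNode] at *
        omega
      · rw [List.mem_singleton] at ha
        subst ha
        simp only [childNode] at *
        omega
    · simp at ha

theorem length_nbrs_le (v : Fin N) : (S.nbrs v).length ≤ 3 := by
  unfold nbrs
  split <;> cases S.parentNode v <;> simp

variable (S)

/-- The underlying graph of a binary forest. -/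
def graph : SimpleGraph (Fin N) where
  Adj v w := w ∈ S.nbrs v
  symm := ⟨fun v w h => by rw [mem_nbrs] at h ⊢; exact h.symm⟩
  loopless := ⟨fun v h => by
    rw [mem_nbrs, or_self] at h
    obtain ⟨h, b, hb⟩ := h
    exact absurd hb (S.lt_ch v h b).ne'⟩

variable {Δ : ℕ} {α : ℝ}

/-- The label of a node of a binary forest. Nodes that are not internal have color `c`. -/
noncomputable def nodeLabel (hΔ : 3 ≤ Δ) (c : Color) (v : Fin N) : ColoredTreeLabel Δ where
  parent := (S.parentNode v).map fun _ => ⟨if v.val < S.m then 2 else 0, by split <;> omega⟩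
  left := if v.val < S.m then some ⟨0, by omega⟩ else none
  right := if v.val < S.m then some ⟨1, by omega⟩ else none
  color := if v.val < S.m then .red else c
  parent_ne_left p hp := by
    rw [Option.map_eq_some_iff] at hp
    obtain ⟨_, -, rfl⟩ := hp
    split <;> simp
  parent_ne_right p hp := by
    rw [Option.map_eq_some_iff] at hp
    obtain ⟨_, -, rfl⟩ := hp
    split <;> simp
  left_ne_right p hp := by
    split at hp
    · rename_i h
      rw [Option.some_inj] at hp
      subst hp
      simp [h]
    · simp at hp

/-- The input given by a binary forest: node `i` has identifier `i + 1`, and the nodes that are not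
internal have color `c`. -/
noncomputable def toGraph (hΔ : 3 ≤ Δ) (hα : 1 ≤ α) (c : Color) :
    LabeledGraph Δ α (ColoredTreeLabel Δ) where
  V := Fin N
  graph := S.graph
  deg v := (S.nbrs v).length
  port v := (nodup_nbrs v).getEquiv
  deg_le v := (length_nbrs_le v).trans hΔ
  ident v := v.val + 1
  ident_injective v w h := Fin.ext (Nat.add_right_cancel h)
  one_le_ident v := Nat.succ_pos _
  ident_le v := by
    have h1 : (v.val + 1 : ℝ) ≤ N := by exact_mod_cast v.2
    have h2 : (1 : ℝ) ≤ N := by exact_mod_cast v.pos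
    rw [Fintype.card_fin]
    push_cast
    exact h1.trans (Real.self_le_rpow_of_one_le h2 hα)
  label v := S.nodeLabel hΔ c v

variable (hΔ : 3 ≤ Δ) (hα : 1 ≤ α)

theorem size_toGraph (c : Color) : (S.toGraph hΔ hα c).size = N := Fintype.card_fin N

theorem neighbor_toGraph (c : Color) (v : Fin N) (j : ℕ) :
    (S.toGraph hΔ hα c).neighbor v j = (S.nbrs v)[j]? := by
  unfold LabeledGraph.neighbor
  by_cases h : j < (S.nbrs v).length
  · rw [List.getElem?_eq_getElem h]
    exact dif_pos h
  · rw [List.getElem?_eq_none (not_lt.1 h)]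
    exact dif_neg h

variable {S}

variable (S) in
/-- The view of a node, which is typed as an element of `Fin N`. -/
noncomputable def nodeView (c : Color) (v : Fin N) : NodeView (ColoredTreeLabel Δ) :=
  (S.toGraph hΔ hα c).view v

theorem nodeView_congr {S' : BinaryForest N} {c c' : Color} {v : Fin N} (h : v.val < S.m)
    (h' : v.val < S'.m) (hp : S.parentNode v = S'.parentNode v) :
    S.nodeView hΔ hα c v = S'.nodeView hΔ hα c' v := by
  simp [nodeView, LabeledGraph.view, toGraph, nodeLabel, nbrs, h, h', hp]

theorem nbrs_getElem_zero {v : Fin N} (h : v.val < S.m) :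
    (S.nbrs v)[0]? = some (S.childNode v h false) := by
  simp [nbrs, h]

theorem nbrs_getElem_one {v : Fin N} (h : v.val < S.m) :
    (S.nbrs v)[1]? = some (S.childNode v h true) := by
  simp [nbrs, h]

theorem nbrs_getElem_add_two {v : Fin N} (h : v.val < S.m) (j : ℕ) :
    (S.nbrs v)[j + 2]? = (S.parentNode v).toList[j]? := by
  simp [nbrs, h]

open LeafColoring

theorem parent_childNode (c : Color) (v : Fin N) (h : v.val < S.m) (b : Bool) :
    parent (S.toGraph hΔ hα c) (S.childNode v h b) = some v := by
  have hp : S.parentNode (S.childNode v h b) = some v :=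
    parentNode_eq_some.2 ⟨h, b, rfl⟩
  unfold parent follow
  have hl : ((S.toGraph hΔ hα c).label (S.childNode v h b)).parent =
      some ⟨if (S.childNode v h b).val < S.m then 2 else 0, by split <;> omega⟩ := by
    change (S.parentNode (S.childNode v h b)).map _ = _
    rw [hp]
    rfl
  rw [hl, Option.bind_some, neighbor_toGraph]
  dsimp only
  split
  · rename_i h'
    rw [nbrs_getElem_add_two h' 0, hp]
    rfl
  · rename_i h'
    simp only [nbrs, h', hp, dite_false, List.nil_append, Option.toList_some]
    rfl

theorem kids_toGraph (c : Color) (v : Fin N) (h : v.val < S.m) :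
    kids (S.toGraph hΔ hα c) v = some (S.childNode v h false, S.childNode v h true) := by
  refine kids_eq_some.2
    ⟨⟨?_, parent_childNode hΔ hα c v h false⟩, ⟨?_, parent_childNode hΔ hα c v h true⟩⟩
  · have : ((S.toGraph hΔ hα c).label v).left = some ⟨0, by omega⟩ := if_pos h
    unfold left follow
    rw [this, Option.bind_some, neighbor_toGraph]
    exact nbrs_getElem_zero h
  · have : ((S.toGraph hΔ hα c).label v).right = some ⟨1, by omega⟩ := if_pos h
    unfold right follow
    rw [this, Option.bind_some, neighbor_toGraph]
    exact nbrs_getElem_one h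

theorem not_isInternal_toGraph (c : Color) (v : Fin N) (h : ¬ v.val < S.m) :
    ¬ IsInternal (S.toGraph hΔ hα c) v := by
  rintro ⟨⟨w, hw, -⟩, -⟩
  have : ((S.toGraph hΔ hα c).label v).left = none := if_neg h
  unfold left follow at hw
  rw [this] at hw
  simp at hw

/-- The only valid output is the constant color of the non-internal nodes. -/
theorem eq_of_mem_leafColoring (c : Color) {out : Fin N → Color}
    (hout : out ∈ leafColoring Δ α (S.toGraph hΔ hα c)) (v : Fin N) : out v = c := by
  induction hk : N - v.val using Nat.strong_induction_on generalizing v with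
  | _ k ih =>
    by_cases h : v.val < S.m
    · have hchild : ∀ b, out (S.childNode v h b) = c := fun b => by
        have h1 := S.lt_ch v h b
        have h2 := S.ch_lt v h b
        exact ih (N - S.ch v b) (by omega) _ rfl
      have hkids := kids_toGraph hΔ hα c v h
      obtain ⟨⟨hl, -⟩, ⟨hr, -⟩⟩ := kids_eq_some.1 hkids
      rcases (hout v).2 (isInternal_iff.2 ⟨_, _, hkids⟩) with ⟨w, hw, hvw⟩ | ⟨w, hw, hvw⟩
      · exact hvw.trans (Option.some_inj.1 (hl.symm.trans hw) ▸ hchild false)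
      · exact hvw.trans (Option.some_inj.1 (hr.symm.trans hw) ▸ hchild true)
    · have hv := not_isInternal_toGraph hΔ hα c v h
      have hcol : ((S.toGraph hΔ hα c).label v).color = c := if_neg h
      refine ((hout v).1 ?_).trans hcol
      by_cases hleaf : IsLeaf (S.toGraph hΔ hα c) v
      · exact Or.inl hleaf
      · exact Or.inr ⟨hv, hleaf⟩

/-! ### Executions on different forests with the same node set -/

/-- The nodes visited in a state, as elements of `Fin N`. -/
noncomputable def seen {S : BinaryForest N} {c : Color} (s : ExecState (S.toGraph hΔ hα c)) : List (Fin N) :=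
  s.visited

/-- Two states of executions on forests with the same node set agree. The states have different
types, but their components have the same types up to unfolding `toGraph`. -/
structure Agree {S S' : BinaryForest N} {c c' : Color} (s : ExecState (S.toGraph hΔ hα c))
    (s' : ExecState (S'.toGraph hΔ hα c')) : Prop where
  history : s.history = s'.history
  visited : seen hΔ hα s = seen hΔ hα s'
  bitsRead : (s.bitsRead : Fin N → ℕ) = s'.bitsRead

variable {O : Type}

/-- The effect of an action, with random bits indexed by `Fin N`. -/
noncomputable def step {S : BinaryForest N} {c : Color} (r : Fin N × ℕ → Bool)
    (s : ExecState (S.toGraph hΔ hα c)) (a : Action O) : ExecState (S.toGraph hΔ hα c) :=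
  Algorithm.act (S.toGraph hΔ hα c) r s a

/-- The next action of an execution from `v` in the state `s`. -/
noncomputable def nextAction {S : BinaryForest N} {c : Color}
    (A : Algorithm (ColoredTreeLabel Δ) O) (v : Fin N) (s : ExecState (S.toGraph hΔ hα c)) :
    Action O :=
  A.next (S.toGraph hΔ hα c).size (S.nodeView hΔ hα c v) s.history

variable (S) in
/-- The state after `t` steps of an execution from `v`. -/
noncomputable def run (c : Color) (A : Algorithm (ColoredTreeLabel Δ) O) (r : Fin N × ℕ → Bool)
    (v : Fin N) (t : ℕ) : ExecState (S.toGraph hΔ hα c) :=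
  A.exec (S.toGraph hΔ hα c) r v t

theorem run_succ (c : Color) (A : Algorithm (ColoredTreeLabel Δ) O) (r : Fin N × ℕ → Bool)
    (v : Fin N) (t : ℕ) : S.run hΔ hα c A r v (t + 1) =
      step hΔ hα r (S.run hΔ hα c A r v t) (nextAction hΔ hα A v (S.run hΔ hα c A r v t)) :=
  rfl

/-- The node reached by a query of port `j` of the visited node with identifier `i`. -/
noncomputable def target (S : BinaryForest N) (l : List (Fin N)) (i j : ℕ) : Option (Fin N) :=
  (l.find? fun w => w.val + 1 == i).bind fun w => (S.nbrs w)[j]?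

theorem target_eq (c : Color) (l : List (Fin N)) (i j : ℕ) :
    ((l : List (S.toGraph hΔ hα c).V).find? fun w => (S.toGraph hΔ hα c).ident w == i).bind
      (fun w => (S.toGraph hΔ hα c).neighbor w j) = S.target l i j := by
  unfold target
  congr 1
  funext w
  exact neighbor_toGraph S hΔ hα c w j

theorem step_query_of_some {c : Color} (r : Fin N × ℕ → Bool) {s : ExecState (S.toGraph hΔ hα c)}
    {i j : ℕ} {u : Fin N} (h : S.target (seen hΔ hα s) i j = some u) :
    step hΔ hα r s (.query i j : Action O) =
      { s with
        history := s.history ++ [.node (S.nodeView hΔ hα c u)]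
        visited := u :: s.visited } := by
  have h' : (s.visited.find? fun w => (S.toGraph hΔ hα c).ident w == i).bind
      (fun w => (S.toGraph hΔ hα c).neighbor w j) = some u :=
    (target_eq hΔ hα c (seen hΔ hα s) i j).trans h
  unfold step Algorithm.act
  dsimp only
  rw [h']
  rfl

theorem step_query_of_none {c : Color} (r : Fin N × ℕ → Bool) {s : ExecState (S.toGraph hΔ hα c)}
    {i j : ℕ} (h : S.target (seen hΔ hα s) i j = none) :
    step hΔ hα r s (.query i j : Action O) =
      { s with history := s.history ++ [.invalid] } := by
  have h' : (s.visited.find? fun w => (S.toGraph hΔ hα c).ident w == i).bind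
      (fun w => (S.toGraph hΔ hα c).neighbor w j) = none :=
    (target_eq hΔ hα c (seen hΔ hα s) i j).trans h
  unfold step Algorithm.act
  dsimp only
  rw [h']

theorem step_readBit_of_some {c : Color} (r : Fin N × ℕ → Bool)
    {s : ExecState (S.toGraph hΔ hα c)} {i : ℕ} {w : Fin N}
    (h : (seen hΔ hα s).find? (fun w => w.val + 1 == i) = some w) :
    step hΔ hα r s (.readBit i : Action O) =
      { s with
        history := s.history ++ [.bit (r (w, s.bitsRead w))]
        bitsRead := fun u : Fin N => if u.val + 1 = i then s.bitsRead u + 1 else s.bitsRead u } := by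
  have h' : s.visited.find? (fun w => (S.toGraph hΔ hα c).ident w == i) = some w := h
  unfold step Algorithm.act
  dsimp only
  rw [h']
  rfl

theorem step_readBit_of_none {c : Color} (r : Fin N × ℕ → Bool)
    {s : ExecState (S.toGraph hΔ hα c)} {i : ℕ}
    (h : (seen hΔ hα s).find? (fun w => w.val + 1 == i) = none) :
    step hΔ hα r s (.readBit i : Action O) =
      { s with history := s.history ++ [.invalid] } := by
  have h' : s.visited.find? (fun w => (S.toGraph hΔ hα c).ident w == i) = none := h
  unfold step Algorithm.act
  dsimp only
  rw [h']

/-- Agreement is preserved by a step whose answer is the same on both forests. -/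
theorem Agree.step {S S' : BinaryForest N} {c c' : Color} {s : ExecState (S.toGraph hΔ hα c)}
    {s' : ExecState (S'.toGraph hΔ hα c')} (h : Agree hΔ hα s s') (r : Fin N × ℕ → Bool)
    (a : Action O)
    (ha : ∀ i j, a = .query i j → S.target (seen hΔ hα s) i j = S'.target (seen hΔ hα s) i j ∧
      ∀ u, S.target (seen hΔ hα s) i j = some u →
        S.nodeView hΔ hα c u = S'.nodeView hΔ hα c' u) :
    Agree hΔ hα (step hΔ hα r s a) (step hΔ hα r s' a) := by
  cases a with
  | output o => exact h
  | query i j =>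
    obtain ⟨h1, h2⟩ := ha i j rfl
    cases ht : S.target (seen hΔ hα s) i j with
    | none =>
      have ht' : S'.target (seen hΔ hα s') i j = none := by rw [← h.visited, ← h1, ht]
      rw [step_query_of_none hΔ hα r ht, step_query_of_none hΔ hα r ht']
      exact ⟨congrArg (· ++ [.invalid]) h.history, h.visited, h.bitsRead⟩
    | some u =>
      have ht' : S'.target (seen hΔ hα s') i j = some u := by rw [← h.visited, ← h1, ht]
      rw [step_query_of_some hΔ hα r ht, step_query_of_some hΔ hα r ht', h2 u ht]
      exact ⟨congrArg (· ++ [.node (S'.nodeView hΔ hα c' u)]) h.history,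
        congrArg (List.cons u) h.visited, h.bitsRead⟩
  | readBit i =>
    have hb := fun w : Fin N => congrFun h.bitsRead w
    cases ht : (seen hΔ hα s).find? fun w => w.val + 1 == i with
    | none =>
      have ht' : ((seen hΔ hα s').find? fun w => w.val + 1 == i) = none := by rw [← h.visited, ht]
      rw [step_readBit_of_none hΔ hα r ht, step_readBit_of_none hΔ hα r ht']
      exact ⟨congrArg (· ++ [.invalid]) h.history, h.visited, h.bitsRead⟩
    | some w =>
      have ht' : ((seen hΔ hα s').find? fun w => w.val + 1 == i) = some w := by
        rw [← h.visited, ht]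
      rw [step_readBit_of_some hΔ hα r ht, step_readBit_of_some hΔ hα r ht']
      refine ⟨?_, h.visited, funext fun u => ?_⟩
      · change s.history ++ [.bit (r (w, s.bitsRead w))] = s'.history ++ [.bit (r (w, s'.bitsRead w))]
        rw [h.history, hb w]
      · change (if u.val + 1 = i then s.bitsRead u + 1 else s.bitsRead u) =
          if u.val + 1 = i then s'.bitsRead u + 1 else s'.bitsRead u
        rw [hb u]

theorem mem_seen_step_query (c : Color) (r : Fin N × ℕ → Bool)
    (s : ExecState (S.toGraph hΔ hα c)) (i j : ℕ) (u : Fin N) :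
    u ∈ seen hΔ hα (step hΔ hα r s (.query i j : Action O)) ↔
      S.target (seen hΔ hα s) i j = some u ∨ u ∈ seen hΔ hα s := by
  cases h : S.target (seen hΔ hα s) i j with
  | none => simp [step_query_of_none hΔ hα r h, seen]
  | some w =>
    rw [step_query_of_some hΔ hα r h, Option.some_inj, eq_comm (a := w)]
    exact List.mem_cons

end BinaryForest

/-! ### Lower bound on the randomized distance complexity -/

namespace BinaryForest

/-- The complete binary tree of depth `d`, with the nodes numbered in breadth-first order. -/
def heap (d : ℕ) : BinaryForest (2 ^ (d + 1) - 1) where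
  m := 2 ^ d - 1
  ch i b := 2 * i + 1 + b.toNat
  lt_ch i _ b := by omega
  ch_lt i hi b := by
    have := b.toNat_le
    rw [pow_succ]
    omega
  inj i _ j _ b b' h := by
    cases b <;> cases b' <;> simp_all <;> omega

theorem log_ch (i : ℕ) (b : Bool) :
    Nat.log 2 (2 * i + 1 + b.toNat + 1) = Nat.log 2 (i + 1) + 1 := by
  have hb := b.toNat_le
  rw [Nat.log_of_one_lt_of_le one_lt_two (by omega)]
  congr 2
  omega

theorem le_add_edist_of_lipschitz {V : Type} (G : SimpleGraph V) (f : V → ℕ)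
    (hf : ∀ v w, G.Adj v w → f w ≤ f v + 1) (v w : V) :
    (f w : ℕ∞) ≤ f v + G.edist v w := by
  have hwalk : ∀ {v w : V} (p : G.Walk v w), f w ≤ f v + p.length := by
    intro v w p
    induction p with
    | nil => simp
    | cons h p ih =>
      rw [SimpleGraph.Walk.length_cons]
      have := hf _ _ h
      omega
  rcases eq_or_ne (G.edist v w) ⊤ with h | h
  · simp [h]
  · obtain ⟨p, hp⟩ := SimpleGraph.exists_walk_of_edist_ne_top h
    rw [← hp]
    exact_mod_cast hwalk p

/-- The depth of a node of the complete binary tree is a lower bound on its distance from the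
root. -/
theorem log_le_edist_heap (d : ℕ) (v u : Fin (2 ^ (d + 1) - 1)) (hv : v.val = 0) :
    (Nat.log 2 (u.val + 1) : ℕ∞) ≤ (heap d).graph.edist v u := by
  have := le_add_edist_of_lipschitz (heap d).graph (fun u => Nat.log 2 (u.val + 1)) ?_ v u
  · simpa [hv] using this
  · intro x y hxy
    rcases mem_nbrs.1 (show y ∈ (heap d).nbrs x from hxy) with ⟨-, b, hb⟩ | ⟨-, b, hb⟩
    · change 2 * x.val + 1 + b.toNat = y.val at hb
      rw [← hb, log_ch]
    · change 2 * y.val + 1 + b.toNat = x.val at hb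
      rw [← hb, log_ch]
      omega

variable {N Δ : ℕ} {α : ℝ} {O : Type} (hΔ : 3 ≤ Δ) (hα : 1 ≤ α)

/-- An execution that visits internal nodes only does not depend on the color of the other nodes. -/
theorem agree_exec_of_internal (S : BinaryForest N) (c c' : Color) (A : Algorithm _ O)
    (r : Fin N × ℕ → Bool) (v : Fin N)
    (hvis : ∀ t, ∀ u ∈ seen hΔ hα (S.run hΔ hα c A r v t), u.val < S.m)
    (t : ℕ) : Agree hΔ hα (S.run hΔ hα c A r v t) (S.run hΔ hα c' A r v t) := by
  induction t with
  | zero => exact ⟨rfl, rfl, rfl⟩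
  | succ t ih =>
    have hv : v.val < S.m := hvis 0 v (List.mem_singleton_self _)
    have hnext : nextAction hΔ hα A v (S.run hΔ hα c' A r v t) =
        nextAction hΔ hα A v (S.run hΔ hα c A r v t) := by
      rw [nextAction, nextAction, ih.history, nodeView_congr hΔ hα (c := c) (c' := c') hv hv rfl]
      rfl
    have hvis' := hvis (t + 1)
    rw [run_succ] at hvis' ⊢
    rw [run_succ, hnext]
    refine ih.step hΔ hα r _ fun i j ha => ⟨rfl, fun u hu => ?_⟩
    have hu' : u.val < S.m := by
      refine hvis' u ?_
      rw [ha, mem_seen_step_query]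
      exact Or.inl hu
    exact nodeView_congr hΔ hα hu' hu' rfl

end BinaryForest

namespace LeafColoring

open BinaryForest

variable {Δ : ℕ} {α : ℝ}

/-- On a complete binary tree of depth `d`, an execution from the root that stays at distance less
than `d` does not see the color of the leaves, which the root has to output. -/
theorem le_distCost_of_mem_randSolvers (hΔ : 3 ≤ Δ) (hα : 1 ≤ α) {K : ℝ} {d n : ℕ}
    (hn : 2 ^ (d + 1) - 1 ≤ n) (hK : 2 * K < (2 ^ (d + 1) - 1 : ℕ))
    {A : Algorithm (ColoredTreeLabel Δ) Color} (hA : A ∈ (leafColoring Δ α).randSolvers K) :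
    (d : ℕ∞) ≤ A.distCost Δ α n := by
  by_contra! hlt
  have hpos : 0 < 2 ^ (d + 1) - 1 := by
    have := Nat.one_lt_two_pow (n := d + 1) (by omega)
    omega
  let v : Fin (2 ^ (d + 1) - 1) := ⟨0, hpos⟩
  have hvis : ∀ (r : Fin (2 ^ (d + 1) - 1) × ℕ → Bool) (t : ℕ) (u : Fin (2 ^ (d + 1) - 1)),
      u ∈ seen hΔ hα ((heap d).run hΔ hα .red A r v t) → u.val < (heap d).m := by
    intro r t u hu
    have h1 : (heap d).graph.edist v u ≤ A.dist ((heap d).toGraph hΔ hα .red) r v :=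
      le_iSup₂ (f := fun w (_ : w ∈ A.visitedSet ((heap d).toGraph hΔ hα .red) r v) =>
        ((heap d).toGraph hΔ hα .red).graph.edist v w) u ⟨t, hu⟩
    have h2 : A.dist ((heap d).toGraph hΔ hα .red) r v ≤ A.distCost Δ α n :=
      le_iSup_of_le ((heap d).toGraph hΔ hα .red) (le_iSup_of_le
        ((size_toGraph _ hΔ hα _).trans_le hn) (le_iSup_of_le r
          (le_iSup (fun w => A.dist ((heap d).toGraph hΔ hα .red) r w) v)))
    have h3 := ((log_le_edist_heap d v u rfl).trans (h1.trans h2)).trans_lt hlt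
    have h4 := (Nat.log_lt_iff_lt_pow one_lt_two u.val.succ_ne_zero).1 (Nat.cast_lt.1 h3)
    change u.val < 2 ^ d - 1
    omega
  -- No random string makes the algorithm succeed for both colors of the leaves.
  have hunion : ∀ r : Fin (2 ^ (d + 1) - 1) × ℕ → Bool,
      ¬ (leafColoring Δ α).Succeeds A ((heap d).toGraph hΔ hα .red) r ∨
      ¬ (leafColoring Δ α).Succeeds A ((heap d).toGraph hΔ hα .blue) r := by
    intro r
    by_contra! h
    obtain ⟨⟨out, ho, hval⟩, ⟨out', ho', hval'⟩⟩ := h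
    obtain ⟨t, ht⟩ := ho v
    rw [eq_of_mem_leafColoring hΔ hα _ hval v] at ht
    have hblue := ho' v
    rw [eq_of_mem_leafColoring hΔ hα _ hval' v] at hblue
    have hv : v.val < (heap d).m := hvis r 0 v (List.mem_singleton_self _)
    change A.next _ ((heap d).nodeView hΔ hα .red v) ((heap d).run hΔ hα .red A r v t).history = _
      at ht
    rw [(agree_exec_of_internal hΔ hα (heap d) .red .blue A r v (hvis r) t).history,
      nodeView_congr hΔ hα (c := .red) (c' := .blue) hv hv rfl] at ht
    exact absurd (Algorithm.outputs_unique (G := (heap d).toGraph hΔ hα .blue) ⟨t, ht⟩ hblue)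
      (by simp)
  have hsmall : ENNReal.ofReal (K / (2 ^ (d + 1) - 1 : ℕ)) < 2⁻¹ := by
    have hp : (0 : ℝ) < (2 ^ (d + 1) - 1 : ℕ) := by exact_mod_cast hpos
    rw [← ENNReal.ofReal_ofNat, ← ENNReal.ofReal_inv_of_pos two_pos,
      ENNReal.ofReal_lt_ofReal_iff (by norm_num), div_lt_iff₀ hp]
    linarith
  have hred := (hA ((heap d).toGraph hΔ hα .red)).1
  have hblue := (hA ((heap d).toGraph hΔ hα .blue)).1
  rw [size_toGraph] at hred hblue
  have huniv : (1 : ENNReal) ≤ ((heap d).toGraph hΔ hα .red).bitMeasure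
      {r | ¬ (leafColoring Δ α).Succeeds A ((heap d).toGraph hΔ hα .red) r} +
      ((heap d).toGraph hΔ hα .blue).bitMeasure
      {r | ¬ (leafColoring Δ α).Succeeds A ((heap d).toGraph hΔ hα .blue) r} := by
    rw [← MeasureTheory.measure_univ (μ := ((heap d).toGraph hΔ hα .red).bitMeasure)]
    exact (MeasureTheory.measure_mono fun r _ => hunion r).trans (MeasureTheory.measure_union_le _ _)
  refine absurd huniv (not_le.2 ?_)
  calc _ < (2⁻¹ : ENNReal) + 2⁻¹ :=
        ENNReal.add_lt_add (hred.trans_lt hsmall) (hblue.trans_lt hsmall)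
    _ = 1 := ENNReal.inv_two_add_inv_two

end LeafColoring

/-! ### Lower bound on the deterministic volume complexity -/

namespace BinaryForest

variable {N Δ : ℕ} {α : ℝ} {O : Type}

/-- A description of a part of a binary tree, with nodes numbered in the order of their discovery:
the entry `(p, b)` at position `i` says that node `i + 1` is the child of node `p` on the side
`b`. -/
structure IsSlotList (l : List (ℕ × Bool)) : Prop where
  nodup : l.Nodup
  le : ∀ (i : ℕ) (h : i < l.length), l[i].1 ≤ i

/-- The nodes `0, …, l.length` are internal nodes of the forest `S`, with the children listed
in `l`. -/
structure Completes (S : BinaryForest N) (l : List (ℕ × Bool)) : Prop where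
  lt : l.length < S.m
  ch : ∀ (i : ℕ) (h : i < l.length), S.ch l[i].1 l[i].2 = i + 1

theorem IsSlotList.append {l : List (ℕ × Bool)} (hl : IsSlotList l) {p : ℕ × Bool}
    (hp : p.1 ≤ l.length) (hpl : p ∉ l) : IsSlotList (l ++ [p]) where
  nodup := by
    rw [List.nodup_append]
    exact ⟨hl.nodup, List.nodup_singleton p, fun a ha b hb => by
      rw [List.mem_singleton] at hb
      rintro rfl
      exact hpl (hb ▸ ha)⟩
  le i h := by
    rw [List.getElem_append]
    split
    · exact hl.le i _
    · rw [List.length_append, List.length_singleton] at h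
      rw [List.getElem_singleton]
      omega

theorem Completes.of_append {S : BinaryForest N} {l : List (ℕ × Bool)} {p : ℕ × Bool}
    (h : S.Completes (l ++ [p])) : S.Completes l ∧ S.ch p.1 p.2 = l.length + 1 := by
  have hlen : (l ++ [p]).length = l.length + 1 := by simp
  refine ⟨⟨?_, fun i hi => ?_⟩, ?_⟩
  · have := h.lt
    omega
  · have := h.ch i (by omega)
    rwa [List.getElem_append_left hi] at this
  · have := h.ch l.length (by omega)
    rwa [List.getElem_concat_length (by rfl)] at this

/-- The children that are not listed get fresh numbers: the children of `p` are
`l.length + 1 + 2 * p` and its successor. Hence three nodes per internal node suffice. -/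
theorem exists_completes {l : List (ℕ × Bool)} (hl : IsSlotList l)
    (hN : 3 * (l.length + 1) ≤ N) : ∃ S : BinaryForest N, S.Completes l := by
  have hidx : ∀ p ∈ l, l.idxOf p < l.length := fun p hp => List.idxOf_lt_length_iff.2 hp
  have hle : ∀ p ∈ l, p.1 ≤ l.idxOf p := by
    intro p hp
    have := hl.le _ (hidx p hp)
    rwa [List.getElem_idxOf] at this
  refine ⟨{
    m := l.length + 1
    ch := fun p b => if (p, b) ∈ l then l.idxOf (p, b) + 1 else l.length + 1 + 2 * p + b.toNat
    lt_ch := fun i hi b => ?_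
    ch_lt := fun i hi b => ?_
    inj := fun i hi j hj b b' h => ?_ }, Nat.lt_succ_self _, fun i hi => ?_⟩
  · split
    · rename_i h
      exact Nat.lt_succ_of_le (hle _ h)
    · omega
  · have := b.toNat_le
    split
    · rename_i h
      have := hidx _ h
      omega
    · omega
  · split at h <;> split at h
    · rename_i h1 h2
      have := (List.idxOf_inj h1).1 (Nat.add_right_cancel h)
      exact ⟨congrArg Prod.fst this, congrArg Prod.snd this⟩
    · rename_i h1 h2
      have := hidx _ h1
      omega
    · rename_i h1 h2
      have := hidx _ h2
      omega
    · cases b <;> cases b' <;> simp_all <;> omega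
  · change (if (l[i].1, l[i].2) ∈ l then l.idxOf (l[i].1, l[i].2) + 1 else _) = i + 1
    rw [if_pos (List.getElem_mem hi)]
    exact congrArg (· + 1) (hl.nodup.idxOf_getElem i hi)

theorem Completes.parentNode_eq {S : BinaryForest N} {l : List (ℕ × Bool)} (hl : IsSlotList l)
    (hS : S.Completes l) {k : Fin N} (hk : k.val ≤ l.length) :
    (k.val = 0 ∧ S.parentNode k = none) ∨
      ∃ (i : ℕ) (hi : i < l.length) (u : Fin N), k.val = i + 1 ∧ u.val = l[i].1 ∧
        S.parentNode k = some u := by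
  rcases Nat.eq_zero_or_pos k.val with h0 | h0
  · refine Or.inl ⟨h0, ?_⟩
    rw [Option.eq_none_iff_forall_ne_some]
    intro u hu
    obtain ⟨h1, b, hb⟩ := parentNode_eq_some.1 hu
    have := S.lt_ch u h1 b
    omega
  · have hi : k.val - 1 < l.length := by omega
    have hle := hl.le _ hi
    refine Or.inr ⟨k.val - 1, hi, ⟨l[k.val - 1].1, by omega⟩, by omega, rfl,
      parentNode_eq_some.2 ⟨?_, l[k.val - 1].2, ?_⟩⟩
    · have := hS.lt
      dsimp only
      omega
    · rw [hS.ch _ hi]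
      omega

theorem Completes.parentNode_congr {S S' : BinaryForest N} {l : List (ℕ × Bool)}
    (hl : IsSlotList l) (hS : S.Completes l) (hS' : S'.Completes l) {k : Fin N}
    (hk : k.val ≤ l.length) : S.parentNode k = S'.parentNode k ∧
      ∀ u, S.parentNode k = some u → u.val ≤ l.length := by
  rcases hS.parentNode_eq hl hk with ⟨h0, h⟩ | ⟨i, hi, u, hki, hu, h⟩ <;>
    rcases hS'.parentNode_eq hl hk with ⟨h0', h'⟩ | ⟨i', hi', u', hki', hu', h'⟩
  · exact ⟨h.trans h'.symm, by simp [h]⟩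
  · omega
  · omega
  · obtain rfl : i = i' := by omega
    obtain rfl : u = u' := Fin.ext (hu.trans hu'.symm)
    refine ⟨h.trans h'.symm, fun w hw => ?_⟩
    rw [h, Option.some_inj] at hw
    subst hw
    have := hl.le i hi
    omega

theorem nbrs_getElem_lt_two {S : BinaryForest N} {v : Fin N} (h : v.val < S.m) {j : ℕ}
    (hj : j < 2) : (S.nbrs v)[j]? = some (S.childNode v h (decide (j = 1))) := by
  interval_cases j
  · exact nbrs_getElem_zero h
  · exact nbrs_getElem_one h

/-- The ports whose other ends are known lead to the same nodes in all completions. -/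
theorem Completes.nbrs_congr {S S' : BinaryForest N} {l : List (ℕ × Bool)}
    (hl : IsSlotList l) (hS : S.Completes l) (hS' : S'.Completes l) {w : Fin N}
    (hw : w.val ≤ l.length) {j : ℕ} (hj : j < 2 → (w.val, decide (j = 1)) ∈ l) :
    (S.nbrs w)[j]? = (S'.nbrs w)[j]? ∧ ∀ u, (S.nbrs w)[j]? = some u → u.val ≤ l.length := by
  have h : w.val < S.m := hw.trans_lt hS.lt
  have h' : w.val < S'.m := hw.trans_lt hS'.lt
  rcases lt_or_ge j 2 with hj2 | hj2
  · obtain ⟨i, hi, hil⟩ := List.getElem_of_mem (hj hj2)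
    have h1 := hS.ch i hi
    have h1' := hS'.ch i hi
    rw [hil] at h1 h1'
    rw [nbrs_getElem_lt_two h hj2, nbrs_getElem_lt_two h' hj2]
    refine ⟨congrArg some (Fin.ext (h1.trans h1'.symm)), fun u hu => ?_⟩
    rw [Option.some_inj] at hu
    subst hu
    change S.ch w _ ≤ _
    rw [h1]
    exact hi
  · obtain ⟨j, rfl⟩ := Nat.exists_eq_add_of_le' hj2
    obtain ⟨h1, h2⟩ := hS.parentNode_congr hl hS' hw
    rw [nbrs_getElem_add_two h, nbrs_getElem_add_two h', ← h1]
    exact ⟨rfl, fun u hu => h2 u (Option.mem_toList.1 (List.mem_of_getElem? hu))⟩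

theorem target_eq_some {S : BinaryForest N} {vis : List (Fin N)} {i j : ℕ} {u : Fin N} :
    S.target vis i j = some u ↔
      ∃ w ∈ vis, w.val + 1 = i ∧ (S.nbrs w)[j]? = some u := by
  unfold target
  rw [Option.bind_eq_some_iff]
  constructor
  · rintro ⟨w, hw, hu⟩
    exact ⟨w, List.mem_of_find?_eq_some hw, by simpa using List.find?_some hw, hu⟩
  · rintro ⟨w, hw, rfl, hu⟩
    refine ⟨w, ?_, hu⟩
    cases hf : vis.find? fun x => x.val + 1 == w.val + 1 with
    | none => simpa using List.find?_eq_none.1 hf w hw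
    | some x =>
      have hx : x.val + 1 = w.val + 1 := by simpa using List.find?_some hf
      rw [Fin.ext (Nat.add_right_cancel hx)]

variable (hΔ : 3 ≤ Δ) (hα : 1 ≤ α)

/-- After `t` steps of the execution of `A` from node `0`, exactly the nodes `0, …, l.length` have
been visited, and the execution is the same on all completions of `l`. The random
string is fixed, since only deterministic algorithms are considered. -/
structure Forced (A : Algorithm (ColoredTreeLabel Δ) O) (hN : 0 < N) (t : ℕ)
    (l : List (ℕ × Bool)) : Prop where
  slots : IsSlotList l
  agree : ∀ (S S' : BinaryForest N) (c c' : Color), S.Completes l → S'.Completes l →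
    Agree hΔ hα (S.run hΔ hα c A (fun _ => false) ⟨0, hN⟩ t)
      (S'.run hΔ hα c' A (fun _ => false) ⟨0, hN⟩ t)
  visited : ∀ (S : BinaryForest N) (c : Color), S.Completes l → ∀ u : Fin N,
    u ∈ (seen hΔ hα (S.run hΔ hα c A (fun _ => false) ⟨0, hN⟩ t)) ↔
      u.val ≤ l.length

theorem Forced.next_congr {A : Algorithm (ColoredTreeLabel Δ) O} {hN : 0 < N} {t : ℕ}
    {l : List (ℕ × Bool)} (h : Forced hΔ hα A hN t l) {S S' : BinaryForest N} (c c' : Color)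
    (hS : S.Completes l) (hS' : S'.Completes l) :
    nextAction hΔ hα A ⟨0, hN⟩ (S.run hΔ hα c A (fun _ => false) ⟨0, hN⟩ t) =
      nextAction hΔ hα A ⟨0, hN⟩ (S'.run hΔ hα c' A (fun _ => false) ⟨0, hN⟩ t) := by
  rw [nextAction, nextAction, (h.agree S S' c c' hS hS').history, size_toGraph, size_toGraph,
    nodeView_congr hΔ hα (c := c) (c' := c') (Nat.zero_lt_of_lt hS.lt)
      (Nat.zero_lt_of_lt hS'.lt)
      (hS.parentNode_congr h.slots hS' (Nat.zero_le _)).1]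

theorem forced_zero (A : Algorithm (ColoredTreeLabel Δ) O) (hN : 0 < N) :
    Forced hΔ hα A hN 0 [] where
  slots := ⟨List.nodup_nil, fun i h => absurd h (Nat.not_lt_zero _)⟩
  agree _ _ _ _ _ _ := ⟨rfl, rfl, rfl⟩
  visited S c _ u := by
    refine List.mem_singleton.trans ?_
    rw [Fin.ext_iff]
    exact Nat.le_zero.symm

/-- The adversary: the answers of the next step can be fixed by adding at most one slot. -/
theorem Forced.succ {A : Algorithm (ColoredTreeLabel Δ) O} (hA : A.IsDeterministic) {hN : 0 < N}
    {t : ℕ} {l : List (ℕ × Bool)} (h : Forced hΔ hα A hN t l) (hlN : 3 * (l.length + 1) ≤ N) :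
    Forced hΔ hα A hN (t + 1) l ∨ ∃ p, Forced hΔ hα A hN (t + 1) (l ++ [p]) := by
  obtain ⟨S0, hS0⟩ := exists_completes h.slots hlN
  obtain ⟨a, ha⟩ : ∃ a, ∀ (S : BinaryForest N) (c : Color), S.Completes l →
      nextAction hΔ hα A ⟨0, hN⟩ (S.run hΔ hα c A (fun _ => false) ⟨0, hN⟩ t) = a :=
    ⟨_, fun S c hS => h.next_congr hΔ hα c .red hS hS0⟩
  cases a with
  | readBit w => exact absurd (ha S0 .red hS0) (hA _ _ _ _)
  | output o =>
    have hexec : ∀ (S : BinaryForest N) (c : Color), S.Completes l →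
        S.run hΔ hα c A (fun _ => false) ⟨0, hN⟩ (t + 1) =
          S.run hΔ hα c A (fun _ => false) ⟨0, hN⟩ t := fun S c hS => by
      rw [run_succ, ha S c hS]
      rfl
    refine Or.inl ⟨h.slots, fun S S' c c' hS hS' => ?_, fun S c hS u => ?_⟩
    · rw [hexec S c hS, hexec S' c' hS']
      exact h.agree S S' c c' hS hS'
    · rw [hexec S c hS]
      exact h.visited S c hS u
  | query i j =>
    by_cases hnew : ∃ x : Fin N, x.val ≤ l.length ∧ x.val + 1 = i ∧ j < 2 ∧
        (x.val, decide (j = 1)) ∉ l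
    · -- An unexplored child is queried: it becomes the node `l.length + 1`.
      obtain ⟨x, hx, hxi, hj, hxl⟩ := hnew
      have hslots := h.slots.append (p := (x.val, decide (j = 1))) hx hxl
      have hlen : (l ++ [(x.val, decide (j = 1))]).length = l.length + 1 := by simp
      have htarget : ∀ (S : BinaryForest N) (c : Color),
          S.Completes (l ++ [(x.val, decide (j = 1))]) →
          S.target (seen hΔ hα (S.run hΔ hα c A (fun _ => false) ⟨0, hN⟩ t)) i j =
            some ⟨l.length + 1, by omega⟩ := by
        intro S c hS
        have hS1 := hS.of_append
        refine target_eq_some.2 ⟨x, (h.visited S c hS1.1 x).2 hx, hxi, ?_⟩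
        rw [nbrs_getElem_lt_two (hx.trans_lt hS1.1.lt) hj]
        exact congrArg some (Fin.ext hS1.2)
      refine Or.inr ⟨_, hslots, fun S S' c c' hS hS' => ?_, fun S c hS u => ?_⟩
      · have hag := h.agree S S' c c' hS.of_append.1 hS'.of_append.1
        rw [run_succ, run_succ, ha S c hS.of_append.1, ha S' c' hS'.of_append.1]
        refine hag.step hΔ hα _ _ fun i' j' hij => ?_
        obtain ⟨rfl, rfl⟩ : i = i' ∧ j = j' := by simpa using hij
        have h2 := htarget S' c' hS'
        rw [← hag.visited] at h2
        refine ⟨(htarget S c hS).trans h2.symm, fun u hu => ?_⟩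
        rw [htarget S c hS, Option.some_inj] at hu
        have hu' : u.val ≤ (l ++ [(x.val, decide (j = 1))]).length := by
          rw [← hu, hlen]
        exact nodeView_congr hΔ hα (hu'.trans_lt hS.lt) (hu'.trans_lt hS'.lt)
          (hS.parentNode_congr hslots hS' hu').1
      · rw [run_succ, ha S c hS.of_append.1, mem_seen_step_query, htarget S c hS,
          h.visited S c hS.of_append.1, hlen, Option.some_inj, Fin.ext_iff]
        dsimp only
        omega
    · push Not at hnew
      have hkey : ∀ (S S' : BinaryForest N) (c : Color), S.Completes l → S'.Completes l →
          S.target (seen hΔ hα (S.run hΔ hα c A (fun _ => false) ⟨0, hN⟩ t)) i j =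
          S'.target (seen hΔ hα (S.run hΔ hα c A (fun _ => false) ⟨0, hN⟩ t)) i j ∧
          ∀ u, S.target (seen hΔ hα (S.run hΔ hα c A (fun _ => false) ⟨0, hN⟩ t))
            i j = some u → u.val ≤ l.length := by
        intro S S' c hS hS'
        have hw : ∀ w : Fin N,
            w ∈ (seen hΔ hα (S.run hΔ hα c A (fun _ => false) ⟨0, hN⟩ t)) →
            w.val + 1 = i → (S.nbrs w)[j]? = (S'.nbrs w)[j]? ∧
              ∀ u, (S.nbrs w)[j]? = some u → u.val ≤ l.length := fun w hw hwi => by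
          have hwl := (h.visited S c hS w).1 hw
          exact hS.nbrs_congr h.slots hS' hwl fun hj => hnew w hwl hwi hj
        constructor
        · refine Option.ext fun u => ?_
          rw [target_eq_some, target_eq_some]
          constructor
          · rintro ⟨w, h1, h2, h3⟩
            exact ⟨w, h1, h2, (hw w h1 h2).1 ▸ h3⟩
          · rintro ⟨w, h1, h2, h3⟩
            exact ⟨w, h1, h2, (hw w h1 h2).1.symm ▸ h3⟩
        · intro u hu
          obtain ⟨w, h1, h2, h3⟩ := target_eq_some.1 hu
          exact (hw w h1 h2).2 u h3
      refine Or.inl ⟨h.slots, fun S S' c c' hS hS' => ?_, fun S c hS u => ?_⟩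
      · rw [run_succ, run_succ, ha S c hS, ha S' c' hS']
        refine (h.agree S S' c c' hS hS').step hΔ hα _ _ fun i' j' hij => ?_
        obtain ⟨rfl, rfl⟩ : i = i' ∧ j = j' := by simpa using hij
        refine ⟨(hkey S S' c hS hS').1, fun u hu => ?_⟩
        have hu' := (hkey S S' c hS hS').2 u hu
        exact nodeView_congr hΔ hα (hu'.trans_lt hS.lt) (hu'.trans_lt hS'.lt)
          (hS.parentNode_congr h.slots hS' hu').1
      · rw [run_succ, ha S c hS, mem_seen_step_query, h.visited S c hS]
        exact or_iff_right_of_imp fun hu => (hkey S S c hS hS).2 u hu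

end BinaryForest

namespace LeafColoring

open BinaryForest

variable {Δ : ℕ} {α : ℝ}

/-- A deterministic algorithm that visits fewer than `M` nodes can be forced to halt before it has
seen any node that is not internal. -/
theorem le_volCost_of_mem_detSolvers (hΔ : 3 ≤ Δ) (hα : 1 ≤ α) {M n : ℕ} (hM : 0 < M)
    (hn : 3 * M ≤ n) {A : Algorithm (ColoredTreeLabel Δ) Color}
    (hA : A ∈ (leafColoring Δ α).detSolvers) : (M : ℕ∞) ≤ A.volCost Δ α n := by
  classical
  by_contra! hlt
  have hN : 0 < n := by omega
  have hlen : ∀ t l, Forced hΔ hα A hN t l → l.length + 1 ≤ M → l.length + 1 < M := by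
    intro t l h hl
    obtain ⟨S, hS⟩ := exists_completes (N := n) h.slots (by omega)
    have h1 : A.vol (S.toGraph hΔ hα .red) (fun _ => false) (⟨0, hN⟩ : Fin n) ≤
        A.volCost Δ α n :=
      le_iSup_of_le (S.toGraph hΔ hα .red) (le_iSup_of_le (size_toGraph S hΔ hα _).le
        (le_iSup_of_le (fun _ => false)
          (le_iSup (fun w => A.vol (S.toGraph hΔ hα .red) (fun _ => false) w) (⟨0, hN⟩ : Fin n))))
    have h2 : ((l.length + 1 : ℕ) : ℕ∞) ≤
        A.vol (S.toGraph hΔ hα .red) (fun _ => false) (⟨0, hN⟩ : Fin n) := by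
      have hcard : ((Finset.univ.map (Fin.castLEEmb (by omega : l.length + 1 ≤ n))).card : ℕ∞) =
          (l.length + 1 : ℕ) := by simp
      rw [← hcard, ← Set.encard_coe_eq_coe_finsetCard]
      refine Set.encard_le_encard fun u hu => ⟨t, (h.visited S .red hS u).2 ?_⟩
      obtain ⟨k, -, rfl⟩ := Finset.mem_map.1 (Finset.mem_coe.1 hu)
      exact Nat.le_of_lt_succ k.2
    exact_mod_cast (h2.trans h1).trans_lt hlt
  -- Consider a forced list of slots of maximal length.
  let P : ℕ → Prop := fun k => ∃ t l, Forced hΔ hα A hN t l ∧ l.length = k ∧ k + 1 ≤ M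
  have hP0 : P 0 := ⟨0, [], forced_zero hΔ hα A hN, rfl, hM⟩
  obtain ⟨t, l, hforced, hlk, hkM⟩ := Nat.findGreatest_spec (P := P) (Nat.zero_le M) hP0
  have hstay : ∀ t', t ≤ t' → Forced hΔ hα A hN t' l := by
    intro t' ht'
    induction ht' with
    | refl => exact hforced
    | step _ ih =>
      rcases ih.succ hΔ hα hA.1 (by omega) with h | ⟨p, h⟩
      · exact h
      · have hlt' := hlen t l hforced (by omega)
        have hPs : P (Nat.findGreatest P M + 1) := ⟨_, _, h, by simp [hlk], by omega⟩
        have := Nat.le_findGreatest (n := M) (by omega) hPs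
        omega
  -- By maximality, the execution never visits a node other than `0, …, l.length`, whatever the
  -- color of the others.
  obtain ⟨S, hS⟩ := exists_completes (N := n) hforced.slots (by omega)
  obtain ⟨out, ho, hval⟩ := hA.2 (S.toGraph hΔ hα .red) fun _ => false
  obtain ⟨out', ho', hval'⟩ := hA.2 (S.toGraph hΔ hα .blue) fun _ => false
  have hred := ho (⟨0, hN⟩ : Fin n)
  have hblue := ho' (⟨0, hN⟩ : Fin n)
  rw [eq_of_mem_leafColoring hΔ hα _ hval ⟨0, hN⟩] at hred
  rw [eq_of_mem_leafColoring hΔ hα _ hval' ⟨0, hN⟩] at hblue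
  obtain ⟨t1, h1⟩ := hred
  have h2 := Algorithm.exec_eq_of_output A _ _ _ (le_max_right t t1) h1
  have hf := hstay (max t t1) (le_max_left _ _)
  rw [← h2] at h1
  change nextAction hΔ hα A ⟨0, hN⟩ (S.run hΔ hα .red A (fun _ => false) ⟨0, hN⟩ _) = _ at h1
  rw [hf.next_congr hΔ hα .red .blue hS hS] at h1
  exact absurd (Algorithm.outputs_unique (G := S.toGraph hΔ hα .blue) ⟨_, h1⟩ hblue) (by simp)

end LeafColoring

/-! ### Asymptotics -/

theorem ofReal_le_toENNReal {y : ℝ} {d : ℕ} {x : ℕ∞} (hy : y ≤ d) (hd : (d : ℕ∞) ≤ x) :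
    ENNReal.ofReal y ≤ ((x : ℕ∞) : ENNReal) := by
  calc ENNReal.ofReal y ≤ ENNReal.ofReal d := ENNReal.ofReal_le_ofReal hy
    _ = ((d : ℕ∞) : ENNReal) := by simp
    _ ≤ _ := ENat.toENNReal_mono hd

theorem toENNReal_le_ofReal {y : ℝ} {d : ℕ} {x : ℕ∞} (hy : (d : ℝ) ≤ y) (hd : x ≤ d) :
    ((x : ℕ∞) : ENNReal) ≤ ENNReal.ofReal y := by
  calc ((x : ℕ∞) : ENNReal) ≤ ((d : ℕ∞) : ENNReal) := ENat.toENNReal_mono hd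
    _ = ENNReal.ofReal d := by simp
    _ ≤ _ := ENNReal.ofReal_le_ofReal hy

theorem natLog_le_two_mul_log (n : ℕ) : (Nat.log 2 n : ℝ) ≤ 2 * Real.log n := by
  have h1 := Real.natLog_le_logb n 2
  have h2 := Real.log_two_gt_d9
  have h3 := Real.log_natCast_nonneg n
  rw [Real.logb, Nat.cast_ofNat, le_div_iff₀ (by linarith)] at h1
  have h4 : (0 : ℝ) ≤ Nat.log 2 n := Nat.cast_nonneg _
  nlinarith

theorem log_le_natLog_add_one {n : ℕ} (hn : 0 < n) : Real.log n ≤ Nat.log 2 n + 1 := by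
  have h : (n : ℝ) ≤ 2 ^ (Nat.log 2 n + 1) := by
    exact_mod_cast (Nat.lt_pow_succ_log_self one_lt_two n).le
  have h1 := Real.log_le_log (by exact_mod_cast hn) h
  rw [Real.log_pow] at h1
  have h2 := Real.log_two_lt_d9
  push_cast at h1
  have h4 : (0 : ℝ) ≤ Nat.log 2 n := Nat.cast_nonneg _
  nlinarith

namespace LeafColoring

variable {Δ : ℕ} {α : ℝ}

open Filter

theorem eventually_le_log (b : ℝ) : ∀ᶠ n : ℕ in atTop, b ≤ Real.log n :=
  (Real.tendsto_log_atTop.comp tendsto_natCast_atTop_atTop).eventually_ge_atTop b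

theorem eventually_log_le_distCost (hΔ : 3 ≤ Δ) (hα : 1 ≤ α) (K : ℝ) :
    ∀ᶠ n : ℕ in atTop, ∃ d : ℕ, 1 / 3 * Real.log n ≤ d ∧
      ∀ A ∈ (leafColoring Δ α).randSolvers K, (d : ℕ∞) ≤ A.distCost Δ α n := by
  filter_upwards [eventually_ge_atTop 4,
    tendsto_natCast_atTop_atTop.eventually_gt_atTop (4 * K + 2)] with n hn hK
  have hlog : 2 ≤ Nat.log 2 n := Nat.le_log_of_pow_le one_lt_two hn
  have hsucc : Nat.log 2 n - 1 + 1 = Nat.log 2 n := by omega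
  refine ⟨Nat.log 2 n - 1, ?_, fun A hA => le_distCost_of_mem_randSolvers hΔ hα ?_ ?_ hA⟩
  · have h1 := log_le_natLog_add_one (n := n) (by omega)
    have h2 : (2 : ℝ) ≤ Nat.log 2 n := by exact_mod_cast hlog
    rw [Nat.cast_sub (by omega), Nat.cast_one]
    linarith
  · rw [hsucc]
    exact (Nat.sub_le _ _).trans (Nat.pow_log_le_self 2 (by omega))
  · rw [hsucc, Nat.cast_sub Nat.one_le_two_pow]
    have h : (n : ℝ) < 2 ^ (Nat.log 2 n + 1) := by
      exact_mod_cast Nat.lt_pow_succ_log_self one_lt_two n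
    rw [pow_succ] at h
    push_cast
    linarith

theorem exists_walkAlgorithm (Δ : ℕ) (α : ℝ) {K : ℝ} (hK : 0 < K) :
    ∃ m, walkAlgorithm Δ m ∈ (leafColoring Δ α).randSolvers K ∧
      ∀ᶠ n : ℕ in atTop,
        (((walkAlgorithm Δ m).volCost Δ α n : ℕ∞) : ENNReal) ≤
          ENNReal.ofReal (17 * Real.log n) := by
  obtain ⟨m, hm⟩ := pow_unbounded_of_one_lt (1 / K) one_lt_two
  refine ⟨m, walkAlgorithm_mem_randSolvers Δ α hK ?_, ?_⟩
  · rw [div_lt_iff₀ hK] at hm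
    linarith
  · filter_upwards [eventually_le_log (4 * m + 13)] with n hn
    refine toENNReal_le_ofReal ?_ (volCost_walkAlgorithm_le Δ α m n)
    have := natLog_le_two_mul_log n
    push_cast
    linarith

end LeafColoring

end VolumeModel

open VolumeModel VolumeModel.LeafColoring in
theorem mainTheorem2 (Δ : ℕ) (hΔ : 3 ≤ Δ) (α : ℝ) (hα : 1 ≤ α) :
    (VolumeModel.leafColoring Δ α).RandComplexityTheta
        (VolumeModel.Algorithm.distCost Δ α) (fun n => Real.log n) ∧
    (VolumeModel.leafColoring Δ α).DetComplexityTheta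
        (VolumeModel.Algorithm.distCost Δ α) (fun n => Real.log n) ∧
    (VolumeModel.leafColoring Δ α).RandComplexityTheta
        (VolumeModel.Algorithm.volCost Δ α) (fun n => Real.log n) ∧
    (VolumeModel.leafColoring Δ α).DetComplexityTheta
        (VolumeModel.Algorithm.volCost Δ α) (fun n => (n : ℝ)) := by
  refine ⟨⟨1 / 3, 17, by norm_num, by norm_num, fun K hK => ⟨?_, ?_⟩⟩,
    ⟨1 / 3, 3, by norm_num, by norm_num, ?_, nearestAlgorithm Δ,
      nearestAlgorithm_mem_detSolvers Δ α, ?_⟩,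
    ⟨1 / 3, 17, by norm_num, by norm_num, fun K hK => ⟨?_, ?_⟩⟩,
    ⟨1 / 4, 1, by norm_num, by norm_num, ?_, nearestAlgorithm Δ,
      nearestAlgorithm_mem_detSolvers Δ α, ?_⟩⟩
  · filter_upwards [eventually_log_le_distCost hΔ hα K] with n ⟨d, hd, h⟩
    exact ofReal_le_toENNReal hd (le_iInf₂ h)
  · obtain ⟨m, hm, h⟩ := exists_walkAlgorithm Δ α hK
    refine ⟨walkAlgorithm Δ m, hm, h.mono fun n hn => le_trans ?_ hn⟩
    exact ENat.toENNReal_mono (Algorithm.distCost_le_volCost _ n)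
  · filter_upwards [eventually_log_le_distCost hΔ hα 1] with n ⟨d, hd, h⟩
    exact ofReal_le_toENNReal hd (le_iInf₂ fun A hA =>
      h A (GraphProblem.detSolvers_subset_randSolvers _ _ hA))
  · filter_upwards [eventually_le_log 2] with n hn
    refine toENNReal_le_ofReal ?_ (distCost_nearestAlgorithm_le Δ α n)
    have := natLog_le_two_mul_log n
    push_cast
    linarith
  · filter_upwards [eventually_log_le_distCost hΔ hα K] with n ⟨d, hd, h⟩
    exact ofReal_le_toENNReal hd (le_iInf₂ fun A hA =>
      (h A hA).trans (Algorithm.distCost_le_volCost A n))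
  · obtain ⟨m, hm, h⟩ := exists_walkAlgorithm Δ α hK
    exact ⟨walkAlgorithm Δ m, hm, h⟩
  · filter_upwards [Filter.eventually_ge_atTop 12] with n hn
    refine ofReal_le_toENNReal (d := n / 3) ?_ (le_iInf₂ fun A hA =>
      le_volCost_of_mem_detSolvers hΔ hα (by omega) (Nat.mul_div_le n 3) hA)
    have h : n ≤ 4 * (n / 3) := by omega
    have h' : (n : ℝ) ≤ 4 * (n / 3 : ℕ) := by exact_mod_cast h
    linarith
  · refine Filter.Eventually.of_forall fun n => ?_
    exact toENNReal_le_ofReal (one_mul _).ge (Algorithm.volCost_le _ n)
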